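/- Let $a>b>0$. The state of the world $\theta$ is uniformly distributed on $\{1,2\}$. Given $\theta$, the private signals $X_1,X_2,\dots\in\{1,2\}$ are i.i.d. with $\mathbb P(X_t=\theta\mid\theta)=\frac{a}{a+b}$ and $\mathbb P(X_t\neq\theta\mid\theta)=\frac{b}{a+b}$. Let $p_1,p_2,\dots\in[0,1]$ be a deterministic sequence, known to all players, and let $I_1,I_2,\dots$ be independent Bernoulli variables with $\mathbb E[I_t]=p_t$, independent of $\theta$ and of the signals. At time $t=1,2,\dots$ player $t$ observes the earlier actions $Z_1,\dots,Z_{t-1}$ (but not $I_1,\dots,I_{t-1}$) and $X_t$. Let $\mathrm{MAP}_t=\mathrm{MAP}(Z_1,\dots,Z_{t-1},X_t)$ be the state with the larger posterior probability given $(Z_1,\dots,Z_{t-1},X_t)$, and $\mathrm{MAP}_t=X_t$ if the two posterior probabilities are equal. If $I_t=1$ (player $t$ is a revealer), then $Z_t=X_t$; if $I_t=0$ (player $t$ is a Bayesian), then $Z_t=\mathrm{MAP}_t$. Put $$\kappa_\star=\kappa_\star(a,b)=\frac{1}{1+\frac{a/b-1}{\log (a/b)}\left(\log\left(\frac{a/b-1}{\log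 (a/b)}\right)-1\right)}.$$ (1) The infimum over all sequences $\{p_t\}_{t\ge1}$ in $[0,1]$ satisfies $$\inf_{\{p_t\}}\ \limsup_{t\to\infty}\ t\,\mathbb P(Z_t\neq\theta)=\kappa_\star(a,b).$$ (2) Let $\varepsilon>0$ and $p_t=\min\left\{(1+\varepsilon)\frac{a+b}{b}\cdot\frac{\kappa_\star}{t},\,1\right\}$ for all $t\ge1$. Then $\lim_{t\to\infty}t\,\mathbb P(Z_t\ne\theta)=(1+\varepsilon)\kappa_\star$ and $\mathbb P(\mathrm{MAP}_t\neq\theta)=o(1/t)$ as $t\to\infty$. (3) Let $\varepsilon>0$ and suppose that $\limsup_{t\to\infty}t\,p_t\le(1-\varepsilon)\frac{a+b}{b}\kappa_\star$. Then $\mathbb P(\mathrm{MAP}_t\neq\theta)=\omega(1/t)$, that is, $\mathbb P(\mathrm{MAP}_t\ne\theta)/(1/t)\to\infty$ as $t\to\infty$. -/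

import Mathlib

open MeasureTheory Filter Topology Asymptotics
open scoped ENNReal

namespace InformationCascade

/-- The constant `κ⋆(a, b)`. -/
noncomputable def kappaStar (a b : ℝ) : ℝ :=
  1 / (1 + (a / b - 1) / Real.log (a / b)
    * (Real.log ((a / b - 1) / Real.log (a / b)) - 1))

/-- Sample space of the model: the state of the world, the private signals of all players, and
the indicators telling which players are revealers. The two states (and the two types of balls)
are `0` and `1` instead of `1` and `2`. The players are indexed by `ℕ`: the player who acts at
time `t + 1` (that is, after `t` other players) has index `t`. -/
abbrev Sample : Type := Fin 2 × (ℕ → Fin 2) × (ℕ → Bool)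

/-- The state of the world. -/
def state (ω : Sample) : Fin 2 := ω.1

/-- The private signal (color of the drawn ball) of the player with index `t`. -/
def signal (t : ℕ) (ω : Sample) : Fin 2 := ω.2.1 t

/-- Whether the player with index `t` is a revealer. -/
def isRevealer (t : ℕ) (ω : Sample) : Bool := ω.2.2 t

/-- Conditional probability of drawing a ball of type `x` when the state of the world is `i`. -/
noncomputable def signalProb (a b : ℝ) (i x : Fin 2) : ℝ :=
  if x = i then a / (a + b) else b / (a + b)

/-- The law of a single private signal when the state of the world is `i`. -/
noncomputable def signalLaw (a b : ℝ) (i : Fin 2) : Measure (Fin 2) :=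
  ∑ x, ENNReal.ofReal (signalProb a b i x) • Measure.dirac x

/-- The law of the model: the state is uniform; given the state, the signals are i.i.d.; the
revealer indicators are independent Bernoulli variables with parameters `p t`, independent of the
state and of the signals. -/
noncomputable def law (a b : ℝ) (p : ℕ → unitInterval) : Measure Sample :=
  ∑ i : Fin 2, (1 / 2 : ℝ≥0∞) • (Measure.dirac i).prod
    ((Measure.infinitePi fun _ : ℕ => signalLaw a b i).prod
      (Measure.infinitePi fun t : ℕ => ProbabilityTheory.bernoulliMeasure true false (p t)))

/-- Posterior probability of the state `i`, given that the observation `obs` has the value `y`. -/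
noncomputable def posterior {α : Type} (μ : Measure Sample) (obs : Sample → α) (y : α)
    (i : Fin 2) : ℝ≥0∞ :=
  ProbabilityTheory.cond μ {ω | obs ω = y} {ω | state ω = i}

/-- What the player with index `t` observes: the actions `h` of the previous players and the
player's own private signal. -/
def observation (h : Sample → List (Fin 2)) (t : ℕ) (ω : Sample) : List (Fin 2) × Fin 2 :=
  (h ω, signal t ω)

/-- The maximum a posteriori estimate of the state by the player with index `t`, where `h` is the
list of the previous actions (as a random variable); if the posteriors are equal, it is the
player's private signal. -/
noncomputable def mapFrom (μ : Measure Sample) (h : Sample → List (Fin 2)) (t : ℕ)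
    (ω : Sample) : Fin 2 :=
  if posterior μ (observation h t) (observation h t ω) 1
      < posterior μ (observation h t) (observation h t ω) 0 then 0
  else if posterior μ (observation h t) (observation h t ω) 0
      < posterior μ (observation h t) (observation h t ω) 1 then 1
  else signal t ω

/-- The actions of the first `t` players, in order. A revealer plays the private signal, every
other player is a Bayesian and plays the maximum a posteriori estimate. -/
noncomputable def history (μ : Measure Sample) : ℕ → Sample → List (Fin 2)
  | 0 => fun _ => []
  | t + 1 => fun ω => history μ t ω ++
      [if isRevealer t ω then signal t ω else mapFrom μ (history μ t) t ω]

/-- The maximum a posteriori estimate of the player with index `t` (whether or not this player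
is a revealer). -/
noncomputable def mapEstimate (μ : Measure Sample) (t : ℕ) (ω : Sample) : Fin 2 :=
  mapFrom μ (history μ t) t ω

/-- The action (guess) of the player with index `t`. -/
noncomputable def action (μ : Measure Sample) (t : ℕ) (ω : Sample) : Fin 2 :=
  if isRevealer t ω then signal t ω else mapEstimate μ t ω

/-- The probability that the action of the player with index `t` is wrong. -/
noncomputable def errorProb (a b : ℝ) (p : ℕ → unitInterval) (t : ℕ) : ℝ :=
  (law a b p).real {ω | action (law a b p) t ω ≠ state ω}

/-- The probability that the maximum a posteriori estimate of the player with index `t` is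
wrong. -/
noncomputable def mapErrorProb (a b : ℝ) (p : ℕ → unitInterval) (t : ℕ) : ℝ :=
  (law a b p).real {ω | mapEstimate (law a b p) t ω ≠ state ω}

end InformationCascade

/-! Write r = a/b. A history matters only through its pair of likelihoods (x, y) under the two
states. Once one likelihood exceeds r times the other, Bayesians ignore their signals (a cascade)
and only revealers can contradict the favoured state. The contradicting action then has probability
q = p·b/(a+b) under the favoured state and r·q under the other. The pairs therefore evolve by the
rule `branch` (`sum_words_eq_treeSum`), and the MAP error is, up to constant factors, the sum of min
x y over all histories (`mapErrorProb_eq`, `nodeError_le`, `mul_min_le_nodeError`): a Chernoff-type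
testing problem. Let S be the sum of the q's so far.

Upper bound (`treeSum_symmGeo_le`): min x y is at most a geometric mean with weight β on the larger
likelihood, and each step multiplies the sum of these means by at most 1 + q·`rate r β`. The minimum
of `rate r` is -1/κ⋆, so the MAP error is at most exp(-S/κ⋆).

Lower bound (`exists_le_treeSum_min`), when p tends to 0: a difference of two geometric means, cut
off outside one cascade region, has a sum decaying no faster than exp(-S/κ⋆). The upper bound at a
slightly larger exponent shows that very large likelihood ratios contribute at most half of it. What
remains is controlled by min x y, at the cost of a factor exp(δS) with δ arbitrarily small.

Balance: if q at time t is about C/t, then S is about C log t and the MAP error is about t^(-C/κ⋆),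
which is o(1/t) for C > κ⋆ and ω(1/t) for C < κ⋆ (`tendsto_mul_mapErrorProb_zero`,
`tendsto_mul_mapErrorProb_atTop`). The total error is q + (1 - p)·(MAP error) (`errorProb_eq`).
Revealing at level C > κ⋆ thus costs C/t and nothing more, while a total error below d/t with d < κ⋆
forces too little revealing. -/

namespace InformationCascade

/-! ### Exponents -/

/-- The exponential rate of the weighted geometric mean `x ^ β * y ^ (1 - β)` of the two
likelihoods per unit of revealed wrong signals. -/
noncomputable def rate (r β : ℝ) : ℝ := r ^ (1 - β) - r + β * (r - 1)

/-- The minimizer of `rate r`. -/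
noncomputable def optExponent (r : ℝ) : ℝ := 1 - Real.log ((r - 1) / Real.log r) / Real.log r

/-- With s = √r this is u < sinh u at u = log s. It places the optimal exponent below 1/2, the range
in which `symmGeo` is useful. -/
lemma sqrt_lt_logMean {r : ℝ} (hr : 1 < r) : √r < (r - 1) / Real.log r := by
  have hs : 1 < √r := by rw [Real.lt_sqrt] <;> linarith
  have hs0 : 0 < √r := by linarith
  have hsq : √r * √r = r := Real.mul_self_sqrt (by linarith)
  have hlog : Real.log r = 2 * Real.log √r := by rw [Real.log_sqrt (by linarith)]; ring
  have hl : 0 < Real.log √r := Real.log_pos hs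
  have h := Real.self_lt_sinh_iff.2 hl
  rw [Real.sinh_eq, Real.exp_neg, Real.exp_log hs0] at h
  rw [lt_div_iff₀ (by linarith), hlog]
  have h2 : √r * (2 * Real.log √r) < √r * (√r - (√r)⁻¹) := by
    apply mul_lt_mul_of_pos_left _ hs0
    linarith
  have h3 : √r * (√r - (√r)⁻¹) = r - 1 := by
    rw [mul_sub, hsq, mul_inv_cancel₀ hs0.ne']
  linarith

lemma logMean_lt {r : ℝ} (hr : 1 < r) : (r - 1) / Real.log r < r := by
  have hl : 0 < Real.log r := Real.log_pos hr
  have h0 : 0 < r := by linarith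
  rw [div_lt_iff₀ hl]
  have h := Real.add_one_lt_exp (x := -Real.log r) (by linarith)
  rw [Real.exp_neg, Real.exp_log h0] at h
  have : r * (1 - r⁻¹) < r * Real.log r := mul_lt_mul_of_pos_left (by linarith) h0
  rwa [mul_sub, mul_inv_cancel₀ h0.ne', mul_one] at this

lemma optExponent_pos {r : ℝ} (hr : 1 < r) : 0 < optExponent r := by
  have hl : 0 < Real.log r := Real.log_pos hr
  have hu : 0 < (r - 1) / Real.log r := div_pos (by linarith) hl
  have := Real.log_lt_log hu (logMean_lt hr)
  rw [optExponent, sub_pos, div_lt_one hl]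
  exact this

lemma optExponent_lt_half {r : ℝ} (hr : 1 < r) : optExponent r < 1 / 2 := by
  have hl : 0 < Real.log r := Real.log_pos hr
  have := Real.log_lt_log (Real.sqrt_pos.2 (by linarith)) (sqrt_lt_logMean hr)
  rw [Real.log_sqrt (by linarith)] at this
  rw [optExponent, sub_lt_comm, lt_div_iff₀ hl]
  linarith

/-- This is the critical point equation: the derivative of `rate r` at β is r - 1 - log r · r ^ (1 -
β). -/
lemma rpow_one_sub_optExponent {r : ℝ} (hr : 1 < r) :
    r ^ (1 - optExponent r) = (r - 1) / Real.log r := by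
  have hl : 0 < Real.log r := Real.log_pos hr
  have hu : 0 < (r - 1) / Real.log r := div_pos (by linarith) hl
  rw [Real.rpow_def_of_pos (by linarith), optExponent, sub_sub_cancel, mul_div_cancel₀ _ hl.ne',
    Real.exp_log hu]

lemma rate_optExponent {r : ℝ} (hr : 1 < r) :
    rate r (optExponent r) =
      -(1 + (r - 1) / Real.log r * (Real.log ((r - 1) / Real.log r) - 1)) := by
  have hl : Real.log r ≠ 0 := (Real.log_pos hr).ne'
  rw [rate, rpow_one_sub_optExponent hr, optExponent]
  field_simp
  ring

lemma rate_neg {r β : ℝ} (hr : 1 < r) (h0 : 0 < β) (h1 : β < 1) : rate r β < 0 := by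
  have h := _root_.rpow_one_add_lt_one_add_mul_self (s := r - 1) (p := 1 - β) (by linarith)
    (by linarith) (by linarith) (by linarith)
  rw [add_sub_cancel] at h
  rw [rate]
  linarith

lemma kappaStar_eq {a b : ℝ} (hb : 0 < b) (hab : b < a) :
    kappaStar a b = (-rate (a / b) (optExponent (a / b)))⁻¹ := by
  rw [rate_optExponent ((one_lt_div hb).2 hab), kappaStar, neg_neg, one_div]

/-- Quantitative form of the minimality of `rate r` at `optExponent r`. -/
lemma rate_sub_rate_optExponent {r β : ℝ} (hr : 1 < r) :
    rate r β - rate r (optExponent r) = (r - 1) / Real.log r *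
      (Real.exp (-((β - optExponent r) * Real.log r)) - 1
        + (β - optExponent r) * Real.log r) := by
  have hl : Real.log r ≠ 0 := (Real.log_pos hr).ne'
  have h : r ^ (1 - β) = (r - 1) / Real.log r *
      Real.exp (-((β - optExponent r) * Real.log r)) := by
    rw [← rpow_one_sub_optExponent hr, Real.rpow_def_of_pos (by linarith),
      Real.rpow_def_of_pos (by linarith), ← Real.exp_add]
    ring_nf
  rw [rate, rate, h, rpow_one_sub_optExponent hr]
  field_simp
  ring

lemma rate_optExponent_lt {r β : ℝ} (hr : 1 < r) (hβ : optExponent r < β) :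
    rate r (optExponent r) < rate r β := by
  have hl : 0 < Real.log r := Real.log_pos hr
  have hu : 0 < (r - 1) / Real.log r := div_pos (by linarith) hl
  rw [← sub_pos, rate_sub_rate_optExponent hr]
  have hx : 0 < (β - optExponent r) * Real.log r := mul_pos (by linarith) hl
  have := Real.add_one_lt_exp (x := -((β - optExponent r) * Real.log r)) (by linarith)
  exact mul_pos hu (by linarith)

/-- Stationarity makes moving to a nearby exponent a second order cost; this is why the lower bound
loses only an arbitrarily small δ. -/
lemma hasDerivAt_rate_optExponent {r : ℝ} (hr : 1 < r) :
    HasDerivAt (rate r) 0 (optExponent r) := by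
  have h0 : 0 < r := by linarith
  have h1 : HasDerivAt (fun β : ℝ => r ^ (1 - β) - r + β * (r - 1))
      (Real.log r * (-1) * r ^ (1 - optExponent r) - 0 + 1 * (r - 1)) (optExponent r) :=
    ((HasDerivAt.const_rpow h0 ((hasDerivAt_id _).const_sub 1)).sub (hasDerivAt_const _ _)).add
      ((hasDerivAt_id _).mul_const _)
  have hl : Real.log r ≠ 0 := (Real.log_pos hr).ne'
  have h2 : Real.log r * (-1) * r ^ (1 - optExponent r) - 0 + 1 * (r - 1) = 0 := by
    rw [rpow_one_sub_optExponent hr]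
    field_simp
    ring
  rw [h2] at h1
  exact h1

/-! ### Geometric means of a likelihood pair -/

/-- Weighted geometric mean of two likelihoods. -/
noncomputable def geo (β x y : ℝ) : ℝ := x ^ β * y ^ (1 - β)

lemma geo_nonneg {β x y : ℝ} (hx : 0 ≤ x) (hy : 0 ≤ y) : 0 ≤ geo β x y :=
  mul_nonneg (Real.rpow_nonneg hx _) (Real.rpow_nonneg hy _)

lemma geo_mul {β x y k l : ℝ} (hx : 0 ≤ x) (hy : 0 ≤ y) (hk : 0 ≤ k) (hl : 0 ≤ l) :
    geo β (x * k) (y * l) = geo β x y * geo β k l := by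
  rw [geo, geo, geo, Real.mul_rpow hx hk, Real.mul_rpow hy hl]
  ring

lemma geo_self_mul {β r u : ℝ} (hr : 0 ≤ r) (hu : 0 ≤ u) : geo β u (r * u) = r ^ (1 - β) * u := by
  rw [geo, Real.mul_rpow hr hu, mul_left_comm, ← Real.rpow_add' hu (by simp), add_sub_cancel,
    Real.rpow_one]

lemma geo_self {β x : ℝ} (hx : 0 ≤ x) : geo β x x = x := by
  simpa using geo_self_mul (β := β) zero_le_one hx

lemma geo_mono {β x y x' y' : ℝ} (hβ : 0 ≤ β) (hβ' : β ≤ 1) (hx : 0 ≤ x) (hy : 0 ≤ y)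
    (hxx : x ≤ x') (hyy : y ≤ y') : geo β x y ≤ geo β x' y' :=
  mul_le_mul (Real.rpow_le_rpow hx hxx hβ) (Real.rpow_le_rpow hy hyy (by linarith))
    (Real.rpow_nonneg hy _) (Real.rpow_nonneg (hx.trans hxx) _)

lemma min_le_geo {β x y : ℝ} (hβ : 0 ≤ β) (hβ' : β ≤ 1) (hx : 0 ≤ x) (hy : 0 ≤ y) :
    min x y ≤ geo β x y :=
  (geo_self (le_min hx hy)).symm.le.trans
    (geo_mono hβ hβ' (le_min hx hy) (le_min hx hy) (min_le_left _ _) (min_le_right _ _))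

/-- The lighter weight β should sit on the larger likelihood. Inside a cascade this identifies which
of the two means realizes `symmGeo`. -/
lemma geo_le_of_le {β x y : ℝ} (hβ : 0 ≤ β) (hβ' : β ≤ 1 / 2) (hy : 0 ≤ y) (hxy : y ≤ x) :
    geo β x y ≤ geo β y x := by
  have hx := hy.trans hxy
  have h1 : y ^ (1 - β) = y ^ β * y ^ (1 - 2 * β) := by
    rw [← Real.rpow_add_of_nonneg hy hβ (by linarith)]; ring_nf
  have h2 : x ^ (1 - β) = x ^ β * x ^ (1 - 2 * β) := by
    rw [← Real.rpow_add_of_nonneg hx hβ (by linarith)]; ring_nf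
  rw [geo, geo, h1, h2]
  have h3 : y ^ (1 - 2 * β) ≤ x ^ (1 - 2 * β) := Real.rpow_le_rpow hy hxy (by linarith)
  have h4 : 0 ≤ x ^ β * y ^ β := mul_nonneg (Real.rpow_nonneg hx _) (Real.rpow_nonneg hy _)
  nlinarith [mul_le_mul_of_nonneg_left h3 h4]

/-- Comparison of geometric means with different weights. -/
lemma geo_le_add {β γ K x y : ℝ} (hβ : 0 < β) (hβγ : β ≤ γ) (hγ : γ < 1) (hK : 0 < K)
    (hx : 0 ≤ x) (hy : 0 ≤ y) :
    geo β x y ≤ K ^ β * y + K ^ (β - γ) * geo γ x y := by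
  rcases hy.eq_or_lt with rfl | hy0
  · rw [geo, Real.zero_rpow (by linarith)]
    have := geo_nonneg (β := γ) hx le_rfl
    have := Real.rpow_nonneg hK.le (β - γ)
    rw [mul_zero, mul_zero, zero_add]
    positivity
  have hg : ∀ δ : ℝ, geo δ x y = (x / y) ^ δ * y := fun δ => by
    rw [geo, Real.div_rpow hx hy, Real.rpow_sub hy0, Real.rpow_one]
    ring
  rw [hg, hg, ← mul_assoc, ← add_mul]
  apply mul_le_mul_of_nonneg_right _ hy
  have hv : 0 ≤ x / y := div_nonneg hx hy
  -- Ratios up to K are charged to y, larger ones to the mean with the larger exponent γ.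
  rcases le_total (x / y) K with h | h
  · exact (Real.rpow_le_rpow hv h hβ.le).trans (le_add_of_nonneg_right (by positivity))
  · have hv0 : 0 < x / y := hK.trans_le h
    have h1 : (x / y) ^ (β - γ) ≤ K ^ (β - γ) :=
      Real.rpow_le_rpow_of_nonpos hK h (by linarith)
    calc (x / y) ^ β = (x / y) ^ (β - γ) * (x / y) ^ γ := by
          rw [← Real.rpow_add hv0, sub_add_cancel]
      _ ≤ K ^ (β - γ) * (x / y) ^ γ := by gcongr
      _ ≤ _ := le_add_of_nonneg_left (by positivity)

/-- Hellinger affinity of the actions of a player in a cascade. -/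
lemma geo_add_geo_le {β r u : ℝ} (h0 : 0 ≤ β) (h1 : β ≤ 1) (hr : 1 ≤ r) (hu : 0 ≤ u)
    (hru : r * u ≤ 1) :
    geo β u (r * u) + geo β (1 - u) (1 - r * u) ≤ 1 + u * rate r β := by
  have h := Real.geom_mean_le_arith_mean2_weighted h0 (sub_nonneg.2 h1)
    (show 0 ≤ 1 - u by nlinarith) (sub_nonneg.2 hru) (by ring)
  rw [geo_self_mul (by linarith) hu, rate]
  rw [geo]
  linarith

/-- `rate r β` is the exact first order coefficient of the affinity, so `geo_add_geo_le` is sharp as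
u tends to 0. -/
lemma hasDerivAt_geo_add_geo {β r : ℝ} :
    HasDerivAt (fun u : ℝ => r ^ (1 - β) * u + geo β (1 - u) (1 - r * u)) (rate r β) 0 := by
  have h1 : HasDerivAt (fun u : ℝ => (1 - u) ^ β) (-β) 0 := by
    have := ((hasDerivAt_id (0 : ℝ)).const_sub 1).rpow_const (p := β) (by simp)
    simpa using this
  have h2 : HasDerivAt (fun u : ℝ => (1 - r * u) ^ (1 - β)) (-(r * (1 - β))) 0 := by
    have := (((hasDerivAt_id (0 : ℝ)).const_mul r).const_sub 1).rpow_const (p := 1 - β) (by simp)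
    simpa using this
  have h3 := ((hasDerivAt_id (0 : ℝ)).const_mul (r ^ (1 - β))).add (h1.mul h2)
  have h4 : r ^ (1 - β) * 1 + (-β * (1 - r * 0) ^ (1 - β) + (1 - 0) ^ β * -(r * (1 - β)))
      = rate r β := by
    simp [rate]
    ring
  rw [h4] at h3
  exact h3

lemma eventually_le_of_deriv_lt {f g : ℝ → ℝ} {f' g' : ℝ} (hf : HasDerivAt f f' 0)
    (hg : HasDerivAt g g' 0) (h0 : f 0 = g 0) (h : f' < g') :
    ∀ᶠ u in 𝓝[≥] (0 : ℝ), f u ≤ g u := by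
  have hd := hg.sub hf
  have hp := (hasDerivAt_iff_tendsto_slope.1 hd).eventually_const_lt (sub_pos.2 h)
  rw [eventually_nhdsWithin_iff] at hp ⊢
  filter_upwards [hp] with u hu hu0
  rcases (Set.mem_Ici.1 hu0).eq_or_lt with rfl | h1
  · exact h0.le
  · have := hu h1.ne'
    rw [slope_def_field, sub_zero] at this
    have := (div_pos_iff_of_pos_right h1).1 this
    simp only [Pi.sub_apply, h0, sub_self, sub_zero] at this
    linarith

/-- For small revealing probabilities, the affinities of the actions of a player in a cascade
compare as their first order terms. -/
lemma eventually_affinity {β γ r : ℝ} (hr : 0 ≤ r) (h : rate r γ < rate r β) :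
    ∀ᶠ u in 𝓝[≥] (0 : ℝ),
      geo γ u (r * u) + geo γ (1 - u) (1 - r * u) ≤ geo β u (r * u) + geo β (1 - u) (1 - r * u) ∧
      Real.exp (rate r γ * u) ≤ geo β u (r * u) + geo β (1 - u) (1 - r * u) := by
  have h1 := eventually_le_of_deriv_lt (hasDerivAt_geo_add_geo (β := γ) (r := r))
    (hasDerivAt_geo_add_geo (β := β) (r := r)) (by simp [geo]) h
  have he : HasDerivAt (fun u : ℝ => Real.exp (rate r γ * u)) (rate r γ) 0 := by
    simpa using ((hasDerivAt_id (0 : ℝ)).const_mul (rate r γ)).exp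
  have h2 := eventually_le_of_deriv_lt he
    (hasDerivAt_geo_add_geo (β := β) (r := r)) (by simp [geo]) h
  filter_upwards [h1, h2, self_mem_nhdsWithin] with u hu1 hu2 hu
  rw [geo_self_mul hr hu, geo_self_mul hr hu]
  exact ⟨hu1, hu2⟩

/-! ### The tree of likelihood pairs -/

/-- Sum of `F` over the two children of a node with likelihood pair `(x, y)`. Here `r` is the
likelihood ratio of a private signal, `B` the probability of a wrong signal and `q` the
probability that a wrong signal is revealed. -/
noncomputable def branch (r B q : ℝ) (F : ℝ → ℝ → ℝ) (x y : ℝ) : ℝ :=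
  if r * x < y then F (x * (r * q)) (y * q) + F (x * (1 - r * q)) (y * (1 - q))
  else if r * y < x then F (x * (1 - q)) (y * (1 - r * q)) + F (x * q) (y * (r * q))
  else F (x * (r * B)) (y * B) + F (x * B) (y * (r * B))

/-- Sum of `F` over the likelihood pairs of all histories of length `t`. -/
noncomputable def treeSum (r B : ℝ) (q : ℕ → ℝ) : ℕ → (ℝ → ℝ → ℝ) → ℝ
  | 0, F => F 1 1
  | t + 1, F => treeSum r B q t (branch r B (q t) F)

section Tree

variable {r B : ℝ} {q : ℕ → ℝ}

lemma branch_mono {q : ℝ} (hr : 0 ≤ r) (hB : 0 ≤ B) (hq : 0 ≤ q) (hq1 : q ≤ 1) (hrq : r * q ≤ 1)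
    {F G : ℝ → ℝ → ℝ} (h : ∀ x y, 0 ≤ x → 0 ≤ y → F x y ≤ G x y) {x y : ℝ} (hx : 0 ≤ x)
    (hy : 0 ≤ y) : branch r B q F x y ≤ branch r B q G x y := by
  have h1 : 0 ≤ 1 - q := sub_nonneg.2 hq1
  have h2 : 0 ≤ 1 - r * q := sub_nonneg.2 hrq
  rw [branch, branch]
  split_ifs <;> exact add_le_add (h _ _ (by positivity) (by positivity))
    (h _ _ (by positivity) (by positivity))

lemma branch_const_mul {q c : ℝ} {F : ℝ → ℝ → ℝ} {x y : ℝ} :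
    branch r B q (fun x y => c * F x y) x y = c * branch r B q F x y := by
  rw [branch, branch]
  split_ifs <;> ring

lemma branch_add {q : ℝ} {F G : ℝ → ℝ → ℝ} {x y : ℝ} :
    branch r B q (fun x y => F x y + G x y) x y = branch r B q F x y + branch r B q G x y := by
  rw [branch, branch, branch]
  split_ifs <;> ring

lemma treeSum_const_mul (c : ℝ) (t : ℕ) (F : ℝ → ℝ → ℝ) :
    treeSum r B q t (fun x y => c * F x y) = c * treeSum r B q t F := by
  induction t generalizing F with
  | zero => rfl
  | succ t ih =>
    rw [treeSum, treeSum, ← ih]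
    congr 1
    ext x y
    exact branch_const_mul

lemma treeSum_add (t : ℕ) (F G : ℝ → ℝ → ℝ) :
    treeSum r B q t (fun x y => F x y + G x y) = treeSum r B q t F + treeSum r B q t G := by
  induction t generalizing F G with
  | zero => rfl
  | succ t ih =>
    rw [treeSum, treeSum, treeSum, ← ih]
    congr 1
    ext x y
    exact branch_add

lemma treeSum_mono (hr : 1 < r) (hB : B * (1 + r) = 1) (hq : ∀ t, 0 ≤ q t) (hqB : ∀ t, q t ≤ B)
    (t : ℕ) {F G : ℝ → ℝ → ℝ} (h : ∀ x y, 0 ≤ x → 0 ≤ y → F x y ≤ G x y) :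
    treeSum r B q t F ≤ treeSum r B q t G := by
  induction t generalizing F G with
  | zero => exact h 1 1 zero_le_one zero_le_one
  | succ t ih =>
    refine ih fun x y hx hy => branch_mono (by linarith) ((hq t).trans (hqB t)) (hq t) ?_ ?_ h hx hy
    · nlinarith [hq t, hqB t]
    · nlinarith [hq t, hqB t]

/-! ### Upper bound for the overlap of the two laws -/

/-- Symmetric potential controlling the error probability from above. -/
noncomputable def symmGeo (β x y : ℝ) : ℝ := min (geo β x y) (geo β y x)

lemma min_le_symmGeo {β x y : ℝ} (hβ : 0 ≤ β) (hβ' : β ≤ 1) (hx : 0 ≤ x) (hy : 0 ≤ y) :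
    min x y ≤ symmGeo β x y :=
  le_min (min_le_geo hβ hβ' hx hy) (by rw [min_comm]; exact min_le_geo hβ hβ' hy hx)

/-- At the children it suffices to use the mean that is smaller at the parent. Geometric means are
multiplicative, so the affinity of one action factors out. -/
lemma branch_symmGeo_le {β q x y : ℝ} (hr : 1 < r) (hB : B * (1 + r) = 1) (hβ : 0 < β)
    (hβ' : β ≤ 1 / 2) (hq : 0 ≤ q) (hqB : q ≤ B) (hx : 0 ≤ x) (hy : 0 ≤ y) :
    branch r B q (symmGeo β) x y ≤ (1 + q * rate r β) * symmGeo β x y := by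
  have hB0 : 0 ≤ B := hq.trans hqB
  have hrq : r * q ≤ 1 := by nlinarith
  have hq1 : q ≤ 1 := by nlinarith
  have hrq0 : 0 ≤ r * q := by positivity
  have h1 : 0 ≤ 1 - q := sub_nonneg.2 hq1
  have h2 : 0 ≤ 1 - r * q := sub_nonneg.2 hrq
  have hrB : 1 - B = r * B := by linarith
  have hrB' : 1 - r * B = B := by linarith
  have hneg := rate_neg hr hβ (by linarith)
  have key := geo_add_geo_le hβ.le (by linarith) hr.le hq hrq
  have keyB := geo_add_geo_le hβ.le (show β ≤ 1 by linarith) hr.le hB0 (by linarith)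
  -- Outside cascades every action equals the signal, which amounts to full revelation u = B. As the
  -- rate is negative and q ≤ B, this contracts at least as much as q does.
  have hmid : geo β B (r * B) + geo β (r * B) B ≤ 1 + q * rate r β := by
    rw [hrB, hrB'] at keyB
    nlinarith
  rw [branch]
  split_ifs with hc hc'
  · have hs : symmGeo β x y = geo β y x := min_eq_right (geo_le_of_le hβ.le hβ' hx (by nlinarith))
    rw [hs]
    calc _ ≤ geo β (y * q) (x * (r * q)) + geo β (y * (1 - q)) (x * (1 - r * q)) :=
          add_le_add (min_le_right _ _) (min_le_right _ _)
      _ = (geo β q (r * q) + geo β (1 - q) (1 - r * q)) * geo β y x := by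
          rw [geo_mul hy hx hq hrq0, geo_mul hy hx h1 h2]; ring
      _ ≤ _ := mul_le_mul_of_nonneg_right key (geo_nonneg hy hx)
  · have hs : symmGeo β x y = geo β x y := min_eq_left (geo_le_of_le hβ.le hβ' hy (by nlinarith))
    rw [hs]
    calc _ ≤ geo β (x * (1 - q)) (y * (1 - r * q)) + geo β (x * q) (y * (r * q)) :=
          add_le_add (min_le_left _ _) (min_le_left _ _)
      _ = (geo β q (r * q) + geo β (1 - q) (1 - r * q)) * geo β x y := by
          rw [geo_mul hx hy hq hrq0, geo_mul hx hy h1 h2]; ring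
      _ ≤ _ := mul_le_mul_of_nonneg_right key (geo_nonneg hx hy)
  · have hf : 0 ≤ 1 + q * rate r β :=
      (add_nonneg (geo_nonneg hB0 (by positivity)) (geo_nonneg (by positivity) hB0)).trans hmid
    rw [show symmGeo β x y = min (geo β x y) (geo β y x) from rfl, mul_min_of_nonneg _ _ hf]
    apply le_min
    · calc _ ≤ geo β (x * (r * B)) (y * B) + geo β (x * B) (y * (r * B)) :=
            add_le_add (min_le_left _ _) (min_le_left _ _)
        _ = (geo β B (r * B) + geo β (r * B) B) * geo β x y := by
            rw [geo_mul hx hy hB0 (by positivity), geo_mul hx hy (by positivity) hB0]; ring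
        _ ≤ _ := mul_le_mul_of_nonneg_right hmid (geo_nonneg hx hy)
    · calc _ ≤ geo β (y * B) (x * (r * B)) + geo β (y * (r * B)) (x * B) :=
            add_le_add (min_le_right _ _) (min_le_right _ _)
        _ = (geo β B (r * B) + geo β (r * B) B) * geo β y x := by
            rw [geo_mul hy hx hB0 (by positivity), geo_mul hy hx (by positivity) hB0]; ring
        _ ≤ _ := mul_le_mul_of_nonneg_right hmid (geo_nonneg hy hx)

lemma treeSum_symmGeo_le {β : ℝ} (hr : 1 < r) (hB : B * (1 + r) = 1) (hβ : 0 < β)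
    (hβ' : β ≤ 1 / 2) (hq : ∀ t, 0 ≤ q t) (hqB : ∀ t, q t ≤ B) (t : ℕ) :
    treeSum r B q t (symmGeo β) ≤ Real.exp (rate r β * ∑ i ∈ Finset.range t, q i) := by
  induction t with
  | zero => simp [treeSum, symmGeo, geo]
  | succ t ih =>
    calc _ ≤ treeSum r B q t fun x y => (1 + q t * rate r β) * symmGeo β x y :=
          treeSum_mono hr hB hq hqB t fun x y hx hy =>
            branch_symmGeo_le hr hB hβ hβ' (hq t) (hqB t) hx hy
      _ ≤ treeSum r B q t fun x y => Real.exp (rate r β * q t) * symmGeo β x y :=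
          treeSum_mono hr hB hq hqB t fun x y hx hy => by
            have h0 : 0 ≤ symmGeo β x y := le_min (geo_nonneg hx hy) (geo_nonneg hy hx)
            have h1 := Real.add_one_le_exp (rate r β * q t)
            exact mul_le_mul_of_nonneg_right (by linarith) h0
      _ = Real.exp (rate r β * q t) * treeSum r B q t (symmGeo β) := treeSum_const_mul _ _ _
      _ ≤ Real.exp (rate r β * q t) * Real.exp (rate r β * ∑ i ∈ Finset.range t, q i) := by
          gcongr
      _ = _ := by
          rw [← Real.exp_add, Finset.sum_range_succ]
          ring_nf

/-! ### Lower bound for the overlap of the two laws -/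

/-- Potential supported on the cascades in which state `0` looks more likely. -/
noncomputable def cascadePotential (r β γ x y : ℝ) : ℝ :=
  max 0 (geo β x (r * y) - geo γ x (r * y))

lemma cascadePotential_nonneg {β γ x y : ℝ} : 0 ≤ cascadePotential r β γ x y := le_max_left _ _

lemma geo_eq_div_rpow {β x y : ℝ} (hx : 0 ≤ x) (hy : 0 < y) : geo β x y = (x / y) ^ β * y := by
  rw [geo, Real.div_rpow hx hy.le, Real.rpow_sub hy, Real.rpow_one]
  ring

lemma cascadePotential_pos {β γ x y : ℝ} (hr : 0 < r) (hγβ : γ < β) (hy : 0 < y)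
    (hxy : r * y < x) : 0 < cascadePotential r β γ x y := by
  have hry : 0 < r * y := by positivity
  rw [cascadePotential, geo_eq_div_rpow (hry.trans hxy).le hry,
    geo_eq_div_rpow (hry.trans hxy).le hry, lt_max_iff, sub_pos]
  exact .inr (mul_lt_mul_of_pos_right
    (Real.rpow_lt_rpow_of_exponent_lt ((one_lt_div hry).2 hxy) hγβ) hry)

/-- The powers β and γ of x / (r * y) cross at 1. The factor r in the potential puts this crossing
exactly on the boundary of the cascade region. -/
lemma cascadePotential_eq_zero {β γ x y : ℝ} (hr : 0 ≤ r) (hγ : 0 < γ) (hγβ : γ ≤ β) (hβ : β < 1)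
    (hx : 0 ≤ x) (hy : 0 ≤ y) (hxy : x ≤ r * y) : cascadePotential r β γ x y = 0 := by
  have hry : 0 ≤ r * y := by positivity
  rw [cascadePotential, max_eq_left_iff, sub_nonpos]
  rcases hry.eq_or_lt with h | h
  · rw [← h, geo, geo, Real.zero_rpow (by linarith), Real.zero_rpow (by linarith), mul_zero,
      mul_zero]
  · rw [geo_eq_div_rpow hx h, geo_eq_div_rpow hx h]
    exact mul_le_mul_of_nonneg_right (Real.rpow_le_rpow_of_exponent_ge' (by positivity)
      ((div_le_one h).2 hxy) hγ.le hγβ) hry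

/-- Inside the cascade the uncut difference satisfies the bound, because the β-mean carries the
larger affinity. Cutting off at 0 only increases the children, so leaving the cascade does no harm,
and outside it the left side vanishes. -/
lemma le_branch_cascadePotential {β γ q x y : ℝ} (hr : 1 < r) (hB : B * (1 + r) = 1) (hγ : 0 < γ)
    (hγβ : γ < β) (hβ : β < 1) (hq : 0 ≤ q) (hqB : q ≤ B)
    (h1 : geo γ q (r * q) + geo γ (1 - q) (1 - r * q)
      ≤ geo β q (r * q) + geo β (1 - q) (1 - r * q))
    (h2 : Real.exp (rate r γ * q) ≤ geo β q (r * q) + geo β (1 - q) (1 - r * q))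
    (hx : 0 ≤ x) (hy : 0 ≤ y) :
    Real.exp (rate r γ * q) * cascadePotential r β γ x y
      ≤ branch r B q (cascadePotential r β γ) x y := by
  have hB0 : 0 ≤ B := hq.trans hqB
  have hrq : r * q ≤ 1 := by nlinarith
  have hq1 : q ≤ 1 := by nlinarith
  have hrq0 : 0 ≤ r * q := by positivity
  have hk1 : 0 ≤ 1 - q := sub_nonneg.2 hq1
  have hk2 : 0 ≤ 1 - r * q := sub_nonneg.2 hrq
  have hry : 0 ≤ r * y := by positivity
  rcases le_or_gt x (r * y) with hxy | hxy
  · rw [cascadePotential_eq_zero (by linarith) hγ hγβ.le hβ hx hy hxy, mul_zero, branch]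
    split_ifs <;> exact add_nonneg cascadePotential_nonneg cascadePotential_nonneg
  rw [branch, if_neg (by nlinarith), if_pos hxy]
  have e : ∀ δ k l : ℝ, 0 ≤ k → 0 ≤ l → geo δ (x * k) (r * (y * l)) =
      geo δ x (r * y) * geo δ k l := fun δ k l hk hl => by
    rw [← mul_assoc, geo_mul hx hry hk hl]
  calc _ ≤ (geo β q (r * q) + geo β (1 - q) (1 - r * q)) * cascadePotential r β γ x y :=
        mul_le_mul_of_nonneg_right h2 cascadePotential_nonneg
    _ ≤ (geo β q (r * q) + geo β (1 - q) (1 - r * q)) * geo β x (r * y)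
        - (geo γ q (r * q) + geo γ (1 - q) (1 - r * q)) * geo γ x (r * y) := by
        have h3 : cascadePotential r β γ x y = geo β x (r * y) - geo γ x (r * y) := by
          rcases hy.eq_or_lt with rfl | hy0
          · simp [cascadePotential, geo, Real.zero_rpow (show 1 - β ≠ 0 by linarith),
              Real.zero_rpow (show 1 - γ ≠ 0 by linarith)]
          · have := cascadePotential_pos (by linarith) hγβ hy0 hxy
            rw [cascadePotential] at this ⊢
            exact max_eq_right ((lt_max_iff.1 this).resolve_left (lt_irrefl _)).le
        rw [h3, mul_sub]
        have := mul_le_mul_of_nonneg_right h1 (geo_nonneg (β := γ) hx hry)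
        linarith
    _ = (geo β (x * (1 - q)) (r * (y * (1 - r * q))) - geo γ (x * (1 - q)) (r * (y * (1 - r * q))))
        + (geo β (x * q) (r * (y * (r * q))) - geo γ (x * q) (r * (y * (r * q)))) := by
        rw [e _ _ _ hk1 hk2, e _ _ _ hk1 hk2, e _ _ _ hq hrq0, e _ _ _ hq hrq0]
        ring
    _ ≤ _ := add_le_add (le_max_right _ _) (le_max_right _ _)

/-- Two initial signals 0 give the ratio r² > r. One signal gives exactly r, which is not yet a
cascade, hence the shift by 2. Afterwards the conforming action has positive probability and
preserves the cascade. -/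
lemma treeSum_pos (hr : 1 < r) (hB : B * (1 + r) = 1) (hq : ∀ t, 0 ≤ q t) (hqB : ∀ t, q t ≤ B)
    (t : ℕ) {F : ℝ → ℝ → ℝ} (h0 : ∀ x y, 0 ≤ F x y) (h1 : ∀ x y, 0 < y → r * y < x → 0 < F x y) :
    0 < treeSum r B q (t + 2) F := by
  have hB0 : 0 < B := by
    by_contra! h
    nlinarith
  induction t generalizing F with
  | zero =>
    have h2 : ∀ q x y, 0 ≤ branch r B q F x y := fun q x y => by
      rw [branch]
      split_ifs <;> exact add_nonneg (h0 _ _) (h0 _ _)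
    rw [treeSum, treeSum, treeSum, branch, if_neg (by linarith), if_neg (by linarith)]
    apply add_pos_of_pos_of_nonneg _ (h2 _ _ _)
    rw [branch, if_neg (by nlinarith), if_neg (by linarith)]
    apply add_pos_of_pos_of_nonneg _ (h0 _ _)
    apply h1
    · positivity
    · have : 0 < r * B * B := by positivity
      nlinarith
  | succ t ih =>
    rw [treeSum]
    apply ih
    · intro x y
      rw [branch]
      split_ifs <;> exact add_nonneg (h0 _ _) (h0 _ _)
    · intro x y hy hxy
      have hq' := hq (t + 2)
      have hqB' := hqB (t + 2)
      have h3 : 0 < 1 - r * q (t + 2) := by nlinarith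
      have h4 : 1 - r * q (t + 2) ≤ 1 - q (t + 2) := by nlinarith
      have hx : 0 < x := (show 0 < r * y by positivity).trans hxy
      rw [branch, if_neg (by nlinarith), if_pos hxy]
      apply add_pos_of_pos_of_nonneg _ (h0 _ _)
      apply h1
      · positivity
      · calc r * (y * (1 - r * q (t + 2))) = r * y * (1 - r * q (t + 2)) := by ring
          _ < x * (1 - r * q (t + 2)) := mul_lt_mul_of_pos_right hxy h3
          _ ≤ _ := mul_le_mul_of_nonneg_left h4 hx.le

/-- Lower bound for the total variation overlap of the laws of the histories. -/
lemma exists_le_treeSum_min {δ : ℝ} (hr : 1 < r) (hB : B * (1 + r) = 1) (hδ : 0 < δ)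
    (hq : ∀ t, 0 ≤ q t) (hqB : ∀ t, q t ≤ B) (hq0 : Tendsto q atTop (𝓝 0)) :
    ∃ c > 0, ∀ᶠ t in atTop,
      c * Real.exp ((rate r (optExponent r) - δ) * ∑ i ∈ Finset.range t, q i)
        ≤ treeSum r B q t min := by
  set γ := optExponent r with hγdef
  have hγ : 0 < γ := optExponent_pos hr
  have hγ' : γ < 1 / 2 := optExponent_lt_half hr
  -- The slope of `rate r` at its stationary point γ tends to 0. The factor 2 is there because β
  -- will be the midpoint of γ and α.
  obtain ⟨α, hγα, hα, hslope⟩ : ∃ α, γ < α ∧ α ≤ 1 / 2 ∧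
      2 * ((rate r α - rate r γ) / (α - γ)) ≤ δ := by
    have h : Tendsto (slope (rate r) γ) (𝓝[>] γ) (𝓝 0) :=
      (hasDerivAt_iff_tendsto_slope.1 (hasDerivAt_rate_optExponent hr)).mono_left
        (nhdsWithin_mono γ fun x hx => (Set.mem_Ioi.1 hx).ne')
    have h1 := h.eventually_lt_const (show 0 < δ / 2 by positivity)
    have h2 : ∀ᶠ x in 𝓝[>] γ, x ∈ Set.Ioc γ (1 / 2) :=
      Ioc_mem_nhdsGT hγ'
    obtain ⟨α, h3, h4⟩ := (h1.and h2).exists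
    refine ⟨α, h4.1, h4.2, ?_⟩
    rw [slope_def_field] at h3
    linarith
  set β := (γ + α) / 2 with hβdef
  have hγβ : γ < β := by linarith
  have hβα : β < α := by linarith
  -- With the cutoff K proportional to exp(σ s), the term K ^ (β - α) * exp(rate α * s) decays
  -- exactly like exp(rate γ * s).
  set σ := (rate r α - rate r γ) / (α - β) with hσdef
  have hσ : σ * (α - β) = rate r α - rate r γ := by
    rw [hσdef, div_mul_cancel₀ _ (by linarith)]
  have hσδ : σ ≤ δ := by
    have : σ = 2 * ((rate r α - rate r γ) / (α - γ)) := by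
      have h1 : α - γ ≠ 0 := by linarith
      have h2 : α - β = (α - γ) / 2 := by rw [hβdef]; ring
      rw [hσdef, h2]
      field_simp
    linarith
  have hσ0 : 0 ≤ σ :=
    div_nonneg (sub_nonneg.2 (rate_optExponent_lt hr hγα).le) (by linarith)
  -- growth of the potential
  have hev : ∀ᶠ t in atTop,
      geo γ (q t) (r * q t) + geo γ (1 - q t) (1 - r * q t)
        ≤ geo β (q t) (r * q t) + geo β (1 - q t) (1 - r * q t) ∧
      Real.exp (rate r γ * q t) ≤ geo β (q t) (r * q t) + geo β (1 - q t) (1 - r * q t) :=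
    (tendsto_nhdsWithin_iff.2 ⟨hq0, .of_forall hq⟩).eventually
      (eventually_affinity (by linarith) (rate_optExponent_lt hr hγβ))
  obtain ⟨T, hT⟩ := eventually_atTop.1 hev
  set s : ℕ → ℝ := fun t => ∑ i ∈ Finset.range t, q i with hs
  set P : ℕ → ℝ := fun t => treeSum r B q t (cascadePotential r β γ) with hP
  have hP0 : 0 < P (T + 2) := treeSum_pos hr hB hq hqB T (fun _ _ => cascadePotential_nonneg)
    fun x y hy hxy => cascadePotential_pos (by linarith) hγβ hy hxy
  have hgrow : ∀ t, T + 2 ≤ t →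
      P (T + 2) * Real.exp (rate r γ * (s t - s (T + 2))) ≤ P t := by
    intro t ht
    induction t, ht using Nat.le_induction with
    | base => simp
    | succ t ht ih =>
      obtain ⟨ha, hb⟩ := hT t (by omega)
      calc _ = Real.exp (rate r γ * q t) *
            (P (T + 2) * Real.exp (rate r γ * (s t - s (T + 2)))) := by
            rw [mul_left_comm, ← Real.exp_add]
            simp only [hs, Finset.sum_range_succ]
            ring_nf
        _ ≤ Real.exp (rate r γ * q t) * P t := by gcongr
        _ = treeSum r B q t fun x y => Real.exp (rate r γ * q t) * cascadePotential r β γ x y :=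
            (treeSum_const_mul _ _ _).symm
        _ ≤ _ := treeSum_mono hr hB hq hqB t fun x y hx hy =>
            le_branch_cascadePotential hr hB hγ hγβ (by linarith) (hq t) (hqB t) ha hb hx hy
  have hsnn : ∀ t, 0 ≤ s t := fun t => Finset.sum_nonneg fun i _ => hq i
  -- the potential is controlled by the overlap
  have hcmp : ∀ (t : ℕ) (K : ℝ), 0 < K → P t ≤ r * (K ^ β * treeSum r B q t min
      + K ^ (β - α) * Real.exp (rate r α * s t)) := by
    intro t K hK
    calc P t ≤ treeSum r B q t fun x y =>
            r * (K ^ β * min x y + K ^ (β - α) * symmGeo α x y) := by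
          apply treeSum_mono hr hB hq hqB t
          intro x y hx hy
          rcases le_or_gt x (r * y) with hxy | hxy
          · rw [cascadePotential_eq_zero (by linarith) hγ hγβ.le (by linarith) hx hy hxy]
            have : 0 ≤ symmGeo α x y := le_min (geo_nonneg hx hy) (geo_nonneg hy hx)
            have := le_min hx hy
            positivity
          have hyx : y ≤ x := by nlinarith
          rw [min_eq_right hyx, symmGeo, min_eq_left (geo_le_of_le (by linarith) hα hy hyx)]
          have h1 : cascadePotential r β γ x y ≤ geo β x (r * y) :=
            max_le (geo_nonneg hx (by positivity))
              (sub_le_self _ (geo_nonneg hx (by positivity)))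
          have h2 : geo β x (r * y) ≤ r * geo β x y := by
            have := geo_mono (β := β) (by linarith) (by linarith) hx (show 0 ≤ r * y by positivity)
              (show x ≤ x * r by nlinarith) (show r * y ≤ y * r by linarith)
            rwa [geo_mul hx hy (by linarith) (by linarith), geo_self (by linarith),
              mul_comm (geo β x y)] at this
          have h3 := geo_le_add (β := β) (γ := α) (by linarith) hβα.le (by linarith) hK hx hy
          nlinarith
      _ = r * (K ^ β * treeSum r B q t min + K ^ (β - α) * treeSum r B q t (symmGeo α)) := by
          rw [treeSum_const_mul, treeSum_add, treeSum_const_mul, treeSum_const_mul]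
      _ ≤ _ := by
          have := treeSum_symmGeo_le hr hB (show 0 < α by linarith) hα hq hqB t
          gcongr
  set c₀ := P (T + 2) * Real.exp (-(rate r γ * s (T + 2))) with hc₀
  have hc₀pos : 0 < c₀ := by positivity
  -- This constant makes the large ratios account for at most half of the lower bound on `P t`.
  obtain ⟨K₀, hK₀, hK₀'⟩ : ∃ K₀ : ℝ, 0 < K₀ ∧ r * K₀ ^ (β - α) = c₀ / 2 := by
    refine ⟨(c₀ / 2 / r) ^ (β - α)⁻¹, by positivity, ?_⟩
    rw [← Real.rpow_mul (by positivity), inv_mul_cancel₀ (by linarith), Real.rpow_one]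
    field_simp
  refine ⟨c₀ / 2 / (r * K₀ ^ β), by positivity, ?_⟩
  filter_upwards [eventually_ge_atTop (T + 2)] with t ht
  have h1 := hgrow t ht
  have h2 := hcmp t (K₀ * Real.exp (σ * s t)) (by positivity)
  have h3 : P (T + 2) * Real.exp (rate r γ * (s t - s (T + 2)))
      = c₀ * Real.exp (rate r γ * s t) := by
    rw [hc₀, mul_assoc, ← Real.exp_add]
    ring_nf
  rw [Real.mul_rpow hK₀.le (Real.exp_pos _).le, Real.mul_rpow hK₀.le (Real.exp_pos _).le,
    ← Real.exp_mul, ← Real.exp_mul, mul_assoc (K₀ ^ (β - α)), ← Real.exp_add] at h2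
  have h4 : σ * s t * (β - α) + rate r α * s t = rate r γ * s t := by
    linear_combination (-s t) * hσ
  rw [h4] at h2
  have h5 : r * (K₀ ^ (β - α) * Real.exp (rate r γ * s t))
      = c₀ / 2 * Real.exp (rate r γ * s t) := by rw [← mul_assoc, hK₀']
  have h6 : c₀ / 2 * Real.exp (rate r γ * s t)
      ≤ r * K₀ ^ β * Real.exp (σ * s t * β) * treeSum r B q t min := by
    rw [h3] at h1
    linarith
  have h7 : Real.exp ((rate r γ - δ) * s t)
      ≤ Real.exp (rate r γ * s t) * Real.exp (-(σ * s t * β)) := by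
    rw [← Real.exp_add, Real.exp_le_exp]
    have : σ * β * s t ≤ δ * s t := by
      apply mul_le_mul_of_nonneg_right _ (hsnn t)
      nlinarith
    linarith
  have hD : 0 < r * K₀ ^ β := by positivity
  rw [div_mul_eq_mul_div, div_le_iff₀ hD]
  calc _ ≤ c₀ / 2 * (Real.exp (rate r γ * s t) * Real.exp (-(σ * s t * β))) := by gcongr
    _ = c₀ / 2 * Real.exp (rate r γ * s t) * Real.exp (-(σ * s t * β)) := by ring
    _ ≤ r * K₀ ^ β * Real.exp (σ * s t * β) * treeSum r B q t min * Real.exp (-(σ * s t * β)) := by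
        gcongr
    _ = treeSum r B q t min * (r * K₀ ^ β) *
          (Real.exp (σ * s t * β) * Real.exp (-(σ * s t * β))) := by ring
    _ = _ := by rw [← Real.exp_add, add_neg_cancel, Real.exp_zero, mul_one]

/-! ### Error of the maximum a posteriori estimate at a node -/

/-- Twice the joint probability of a node with likelihood pair `(x, y)` and of a wrong maximum a
posteriori estimate at this node. -/
noncomputable def nodeError (r B x y : ℝ) : ℝ :=
  if r * x < y then x else if r * y < x then y else B * (x + y)

/-- Outside cascades y ≤ r x and x ≤ r y, so B (x + y) is at most B (1 + r) = 1 times either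
likelihood. -/
lemma nodeError_le {x y : ℝ} (hr : 1 < r) (hB : B * (1 + r) = 1) (hx : 0 ≤ x) (hy : 0 ≤ y) :
    nodeError r B x y ≤ min x y := by
  have hB0 : 0 < B := by
    by_contra! h
    nlinarith
  rw [nodeError]
  split_ifs with h1 h2
  · exact le_min le_rfl (by nlinarith)
  · exact le_min (by nlinarith) le_rfl
  · exact le_min (by nlinarith) (by nlinarith)

lemma mul_min_le_nodeError {x y : ℝ} (hr : 1 < r) (hB : B * (1 + r) = 1) (hx : 0 ≤ x)
    (hy : 0 ≤ y) : B * min x y ≤ nodeError r B x y := by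
  have hB0 : 0 < B := by
    by_contra! h
    nlinarith
  have hB1 : B ≤ 1 := by nlinarith
  have h0 : 0 ≤ min x y := le_min hx hy
  have hl := min_le_left x y
  have hr' := min_le_right x y
  rw [nodeError]
  split_ifs with h1 h2 <;> nlinarith

end Tree

/-! ### Independence of the past from the present -/

/-- Signals and revealer indicators of all players. -/
abbrev Inputs : Type := (ℕ → Fin 2) × (ℕ → Bool)

/-- An event determined by the first t coordinates is the preimage of a set of prefixes; over a
finite alphabet every such set is measurable, so independence of coordinates applies. -/
lemma infinitePi_inter_eval {α : Type*} [Finite α] [MeasurableSpace α]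
    [MeasurableSingletonClass α] (P : ℕ → Measure α) [∀ t, IsProbabilityMeasure (P t)] (t : ℕ)
    {S : Set (ℕ → α)} (hS : ∀ x y, (∀ i < t, x i = y i) → x ∈ S → y ∈ S) (c : α) :
    Measure.infinitePi P (S ∩ {x | x t = c}) = Measure.infinitePi P S * P t {c} := by
  have hind := ProbabilityTheory.iIndepFun.indepFun_finset (Finset.range t) {t} (by simp)
    (ProbabilityTheory.iIndepFun_infinitePi (P := P) (X := fun _ x => x) (by fun_prop))
    (by fun_prop)
  have h1 : S = (fun (x : ℕ → α) (i : Finset.range t) => x i) ⁻¹'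
      ((fun (x : ℕ → α) (i : Finset.range t) => x i) '' S) := by
    refine Set.Subset.antisymm (Set.subset_preimage_image _ _) ?_
    rintro y ⟨x, hx, hxy⟩
    exact hS x y (fun i hi => congr_fun hxy ⟨i, Finset.mem_range.2 hi⟩) hx
  have h2 : {x : ℕ → α | x t = c} = (fun (x : ℕ → α) (i : ({t} : Finset ℕ)) => x i) ⁻¹'
      {g | g ⟨t, Finset.mem_singleton_self t⟩ = c} := rfl
  have h3 : Measure.infinitePi P {x | x t = c} = P t {c} := by
    rw [← Measure.infinitePi_map_eval P t, Measure.map_apply (by fun_prop) (by simp)]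
    rfl
  rw [← h3]
  rw [h1, h2]
  exact hind.measure_inter_preimage_eq_mul _ _ (Set.toFinite _).measurableSet
    (Set.toFinite _).measurableSet

lemma measurableSet_of_forall_lt (t : ℕ) {S : Set Inputs}
    (hS : ∀ x y : Inputs, (∀ i < t, x.1 i = y.1 i ∧ x.2 i = y.2 i) → x ∈ S → y ∈ S) :
    MeasurableSet S := by
  let f : Inputs → (Finset.range t → Fin 2 × Bool) := fun x i => (x.1 i, x.2 i)
  have hf : Measurable f := by fun_prop
  have h1 : S = f ⁻¹' (f '' S) := by
    refine Set.Subset.antisymm (Set.subset_preimage_image _ _) ?_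
    rintro y ⟨x, hx, hxy⟩
    exact hS x y (fun i hi => Prod.ext_iff.1 (congr_fun hxy ⟨i, Finset.mem_range.2 hi⟩)) hx
  rw [h1]
  exact hf (Set.toFinite _).measurableSet

lemma signalProb_nonneg {a b : ℝ} (ha : 0 ≤ a) (hb : 0 ≤ b) (i x : Fin 2) :
    0 ≤ signalProb a b i x := by
  rw [signalProb]
  split_ifs <;> positivity

lemma signalLaw_singleton {a b : ℝ} (i x : Fin 2) :
    signalLaw a b i {x} = ENNReal.ofReal (signalProb a b i x) := by
  fin_cases x <;> simp [signalLaw, Fin.sum_univ_two]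

lemma isProbabilityMeasure_signalLaw {a b : ℝ} (ha : 0 < a) (hb : 0 < b) (i : Fin 2) :
    IsProbabilityMeasure (signalLaw a b i) := by
  constructor
  have h : a / (a + b) + b / (a + b) = 1 := by field_simp
  have h1 : 0 ≤ a / (a + b) := by positivity
  have h2 : 0 ≤ b / (a + b) := by positivity
  fin_cases i <;> simp [signalLaw, Fin.sum_univ_two, signalProb, ← ENNReal.ofReal_add, h1, h2, h,
    add_comm (b / (a + b))]

/-- Law of the signals and of the revealer indicators, given the state of the world. -/
noncomputable def condLaw (a b : ℝ) (p : ℕ → unitInterval) (i : Fin 2) : Measure Inputs :=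
  (Measure.infinitePi fun _ : ℕ => signalLaw a b i).prod
    (Measure.infinitePi fun t : ℕ => ProbabilityTheory.bernoulliMeasure true false (p t))

/-- Probability that the revealer indicator with parameter `p` has the value `e`. -/
noncomputable def revealProb (p : ℝ) (e : Bool) : ℝ := if e then p else 1 - p

lemma bernoulliMeasure_singleton (p : unitInterval) (e : Bool) :
    (ProbabilityTheory.bernoulliMeasure true false p).real {e} = revealProb p e := by
  classical
  rw [ProbabilityTheory.bernoulliMeasure_real_apply _ (by simp)]
  cases e <;> simp [revealProb]

section Model

variable {a b : ℝ} {p : ℕ → unitInterval}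

lemma isProbabilityMeasure_condLaw (ha : 0 < a) (hb : 0 < b) (i : Fin 2) :
    IsProbabilityMeasure (condLaw a b p i) := by
  have := isProbabilityMeasure_signalLaw ha hb i
  rw [condLaw]
  infer_instance

/-- S mixes signals and indicators, so the two current coordinates are split off one at a time: the
indicator on slices with fixed signals, then the signal on slices with fixed indicators. -/
lemma condLaw_real_inter (ha : 0 < a) (hb : 0 < b) (i : Fin 2) (t : ℕ) {S : Set Inputs}
    (hS : ∀ x y : Inputs, (∀ j < t, x.1 j = y.1 j ∧ x.2 j = y.2 j) → x ∈ S → y ∈ S)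
    (x : Fin 2) (e : Bool) :
    (condLaw a b p i).real (S ∩ {ω | ω.1 t = x ∧ ω.2 t = e})
      = (condLaw a b p i).real S * signalProb a b i x * revealProb (p t) e := by
  have := isProbabilityMeasure_signalLaw ha hb i
  have hSm := measurableSet_of_forall_lt t hS
  have hm1 : MeasurableSet {ω : Inputs | ω.1 t = x} :=
    (show Measurable fun ω : Inputs => ω.1 t by fun_prop) (measurableSet_singleton x)
  have hm2 : MeasurableSet {ω : Inputs | ω.2 t = e} :=
    (show Measurable fun ω : Inputs => ω.2 t by fun_prop) (measurableSet_singleton e)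
  have h1 : condLaw a b p i ((S ∩ {ω | ω.1 t = x}) ∩ {ω | ω.2 t = e})
      = condLaw a b p i (S ∩ {ω | ω.1 t = x})
        * ProbabilityTheory.bernoulliMeasure true false (p t) {e} := by
    rw [condLaw, Measure.prod_apply ((hSm.inter hm1).inter hm2), Measure.prod_apply (hSm.inter hm1),
      ← lintegral_mul_const' _ _ (measure_ne_top _ _)]
    congr 1
    ext σ
    by_cases hσ : σ t = x
    · have := infinitePi_inter_eval
        (fun t : ℕ => ProbabilityTheory.bernoulliMeasure true false (p t)) t
        (S := Prod.mk σ ⁻¹' S) (fun u v huv => hS _ _ fun j hj => ⟨rfl, huv j hj⟩) e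
      rw [show Prod.mk σ ⁻¹' (S ∩ {ω : Inputs | ω.1 t = x}) = Prod.mk σ ⁻¹' S by ext; simp [hσ],
        ← this]
      congr 1
      ext
      simp [hσ]
    · rw [show Prod.mk σ ⁻¹' (S ∩ {ω : Inputs | ω.1 t = x} ∩ {ω | ω.2 t = e}) = ∅ by
          ext; simp [hσ],
        show Prod.mk σ ⁻¹' (S ∩ {ω : Inputs | ω.1 t = x}) = ∅ by ext; simp [hσ]]
      simp
  have h2 : condLaw a b p i (S ∩ {ω | ω.1 t = x})
      = condLaw a b p i S * signalLaw a b i {x} := by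
    rw [condLaw, Measure.prod_apply_symm (hSm.inter hm1), Measure.prod_apply_symm hSm,
      ← lintegral_mul_const' _ _ (measure_ne_top _ _)]
    congr 1
    ext τ
    exact infinitePi_inter_eval (fun _ : ℕ => signalLaw a b i) t
      (S := (fun σ => (σ, τ)) ⁻¹' S) (fun u v huv => hS _ _ fun j hj => ⟨huv j hj, rfl⟩) x
  have h3 : S ∩ {ω : Inputs | ω.1 t = x ∧ ω.2 t = e}
      = (S ∩ {ω | ω.1 t = x}) ∩ {ω | ω.2 t = e} := by
    ext
    simp [and_assoc]
  rw [h3, measureReal_def, h1, h2, ENNReal.toReal_mul, ENNReal.toReal_mul, signalLaw_singleton,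
    ENNReal.toReal_ofReal (signalProb_nonneg ha.le hb.le i x), ← bernoulliMeasure_singleton]
  rfl

lemma law_real_eq (ha : 0 < a) (hb : 0 < b) {E : Set Sample}
    (hE : ∀ i, MeasurableSet {ω : Inputs | ((i, ω) : Sample) ∈ E}) :
    (law a b p).real E = ((condLaw a b p 0).real {ω | ((0, ω) : Sample) ∈ E}
      + (condLaw a b p 1).real {ω | ((1, ω) : Sample) ∈ E}) / 2 := by
  have h0 := isProbabilityMeasure_condLaw (p := p) ha hb 0
  have h1 := isProbabilityMeasure_condLaw (p := p) ha hb 1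
  have hEm : MeasurableSet E := by
    have : E = ⋃ i, ({i} : Set (Fin 2)) ×ˢ {ω : Inputs | ((i, ω) : Sample) ∈ E} := by
      ext ⟨i, ω⟩
      simp
    rw [this]
    exact .iUnion fun i => (measurableSet_singleton i).prod (hE i)
  have h : law a b p E = (1 / 2 : ℝ≥0∞) * condLaw a b p 0 {ω | ((0, ω) : Sample) ∈ E}
      + (1 / 2 : ℝ≥0∞) * condLaw a b p 1 {ω | ((1, ω) : Sample) ∈ E} := by
    have hd : ∀ i, ((Measure.dirac i).prod (condLaw a b p i)) E
        = condLaw a b p i {ω | ((i, ω) : Sample) ∈ E} := fun i => by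
      have := isProbabilityMeasure_condLaw (p := p) ha hb i
      rw [Measure.dirac_prod, Measure.map_apply measurable_prodMk_left hEm]
      rfl
    rw [← hd, ← hd]
    simp [law, condLaw, Fin.sum_univ_two]
  rw [measureReal_def, h, ENNReal.toReal_add (by finiteness) (by finiteness), ENNReal.toReal_mul,
    ENNReal.toReal_mul, measureReal_def, measureReal_def]
  simp
  ring

/-! ### Histories -/

/-- The two states may differ: the state affects actions only through the law of the signals. -/
lemma history_congr (μ : Measure Sample) (t : ℕ) {ω ω' : Sample}
    (h : ∀ i < t, ω.2.1 i = ω'.2.1 i ∧ ω.2.2 i = ω'.2.2 i) : history μ t ω = history μ t ω' := by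
  induction t with
  | zero => rfl
  | succ t ih =>
    have h1 := ih fun i hi => h i (by omega)
    have h2 := h t (by omega)
    simp only [history, isRevealer, signal, mapFrom, observation, h1, h2]
    rfl

/-- All words of length `t`. -/
def words : ℕ → Finset (List (Fin 2))
  | 0 => {[]}
  | t + 1 => (words t ×ˢ Finset.univ).image fun u => u.1 ++ [u.2]

lemma sum_words_succ (t : ℕ) (f : List (Fin 2) → ℝ) :
    ∑ h ∈ words (t + 1), f h = ∑ h ∈ words t, (f (h ++ [0]) + f (h ++ [1])) := by
  rw [words, Finset.sum_image, Finset.sum_product]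
  · simp [Fin.sum_univ_two]
  · rintro ⟨h, z⟩ - ⟨h', z'⟩ - hh
    simpa using hh

lemma history_mem_words (μ : Measure Sample) (t : ℕ) (ω : Sample) : history μ t ω ∈ words t := by
  induction t with
  | zero => simp [history, words]
  | succ t ih =>
    simp only [history, words, Finset.mem_image, Finset.mem_product]
    exact ⟨(_, _), ⟨ih, Finset.mem_univ _⟩, rfl⟩

variable (a b p) in
/-- Conditional probability of the history `h` of length `t`, given the state `i`. -/
noncomputable def weight (i : Fin 2) (t : ℕ) (h : List (Fin 2)) : ℝ :=
  (condLaw a b p i).real {ω | history (law a b p) t (i, ω) = h}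

lemma weight_nonneg (i : Fin 2) (t : ℕ) (h : List (Fin 2)) : 0 ≤ weight a b p i t h :=
  measureReal_nonneg

lemma history_eq_of_forall_lt {μ : Measure Sample} {i : Fin 2} {t : ℕ} {h : List (Fin 2)}
    (x y : Inputs) (hxy : ∀ j < t, x.1 j = y.1 j ∧ x.2 j = y.2 j)
    (hx : x ∈ {ω : Inputs | history μ t (i, ω) = h}) :
    y ∈ {ω : Inputs | history μ t (i, ω) = h} := by
  rw [Set.mem_ofPred_eq] at hx ⊢
  rw [← hx]
  exact history_congr μ t fun j hj => ⟨(hxy j hj).1.symm, (hxy j hj).2.symm⟩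

lemma measurableSet_event {μ : Measure Sample} (i : Fin 2) (t : ℕ)
    (Q : List (Fin 2) → Fin 2 → Bool → Prop) :
    MeasurableSet {ω : Inputs | Q (history μ t (i, ω)) (ω.1 t) (ω.2 t)} := by
  refine measurableSet_of_forall_lt (t + 1) fun x y hxy hx => ?_
  rw [Set.mem_ofPred_eq] at hx ⊢
  rw [history_congr μ t (ω := (i, y)) (ω' := (i, x)) fun j hj =>
    ⟨(hxy j (by omega)).1.symm, (hxy j (by omega)).2.symm⟩, ← (hxy t (by omega)).1,
    ← (hxy t (by omega)).2]
  exact hx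

/-- Joint law of the history, the current signal and the current revealer indicator. -/
lemma condLaw_real_event (ha : 0 < a) (hb : 0 < b) (i : Fin 2) (t : ℕ)
    (Q : List (Fin 2) → Fin 2 → Bool → Prop) [∀ h x e, Decidable (Q h x e)] :
    (condLaw a b p i).real {ω | Q (history (law a b p) t (i, ω)) (ω.1 t) (ω.2 t)}
      = ∑ h ∈ words t, ∑ x, ∑ e, if Q h x e then
          weight a b p i t h * signalProb a b i x * revealProb (p t) e else 0 := by
  have := isProbabilityMeasure_condLaw (p := p) ha hb i
  let g : Inputs → List (Fin 2) × Fin 2 × Bool := fun ω =>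
    (history (law a b p) t (i, ω), ω.1 t, ω.2 t)
  let V : Finset (List (Fin 2) × Fin 2 × Bool) := words t ×ˢ Finset.univ
  have hg : ∀ v, g ⁻¹' {v} = {ω | history (law a b p) t (i, ω) = v.1} ∩
      {ω | ω.1 t = v.2.1 ∧ ω.2 t = v.2.2} := fun v => by
    ext ω
    simp [g, Prod.ext_iff]
  have h1 : {ω : Inputs | Q (history (law a b p) t (i, ω)) (ω.1 t) (ω.2 t)}
      = g ⁻¹' ↑(V.filter fun v => Q v.1 v.2.1 v.2.2) := by
    ext ω
    simp [g, V, history_mem_words]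
  rw [h1, ← sum_measureReal_preimage_singleton, Finset.sum_filter]
  · rw [Finset.sum_product]
    refine Finset.sum_congr rfl fun h _ => ?_
    rw [Fintype.sum_prod_type]
    refine Finset.sum_congr rfl fun x _ => Finset.sum_congr rfl fun e _ => ?_
    rw [hg, condLaw_real_inter ha hb i t history_eq_of_forall_lt]
    rfl
  · intro v _
    have := measurableSet_event (μ := law a b p) i t fun h x e => (h, x, e) = v
    exact this

lemma sum_words_weight (ha : 0 < a) (hb : 0 < b) (i : Fin 2) (t : ℕ) :
    ∑ h ∈ words t, weight a b p i t h = 1 := by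
  have := isProbabilityMeasure_condLaw (p := p) ha hb i
  have h := condLaw_real_event (p := p) ha hb i t fun _ _ _ => True
  have hs : a / (a + b) + b / (a + b) = 1 := by field_simp
  simp only [Set.ofPred_true, probReal_univ, if_true] at h
  rw [h]
  refine Finset.sum_congr rfl fun u _ => ?_
  fin_cases i <;> simp [revealProb, signalProb] <;> linear_combination (-weight a b p _ t u) * hs

variable (a b p) in
/-- Decision of a Bayesian player with index `t`, given the history `h` and the signal `x`. -/
noncomputable def decision (t : ℕ) (h : List (Fin 2)) (x : Fin 2) : Fin 2 :=
  if posterior (law a b p) (observation (history (law a b p) t) t) (h, x) 1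
      < posterior (law a b p) (observation (history (law a b p) t) t) (h, x) 0 then 0
  else if posterior (law a b p) (observation (history (law a b p) t) t) (h, x) 0
      < posterior (law a b p) (observation (history (law a b p) t) t) (h, x) 1 then 1
  else x

lemma history_succ (t : ℕ) (ω : Sample) :
    history (law a b p) (t + 1) ω = history (law a b p) t ω ++
      [if isRevealer t ω then signal t ω
        else decision a b p t (history (law a b p) t ω) (signal t ω)] := rfl

lemma isProbabilityMeasure_law (ha : 0 < a) (hb : 0 < b) : IsProbabilityMeasure (law a b p) := by
  have h0 := isProbabilityMeasure_condLaw (p := p) ha hb 0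
  have h1 := isProbabilityMeasure_condLaw (p := p) ha hb 1
  have h := law_real_eq (p := p) ha hb (E := Set.univ) (by simp)
  have h2 : (law a b p).real Set.univ = 1 := by
    rw [h]
    simp
  constructor
  rw [measureReal_def] at h2
  exact (ENNReal.toReal_eq_one_iff _).1 h2

/-- Bayes' rule: the uniform prior and the normalizing constant cancel. -/
lemma posterior_lt_posterior (ha : 0 < a) (hb : 0 < b) {t : ℕ} {h : List (Fin 2)}
    (hh : h ∈ words t) (x i j : Fin 2) :
    posterior (law a b p) (observation (history (law a b p) t) t) (h, x) i
      < posterior (law a b p) (observation (history (law a b p) t) t) (h, x) j ↔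
    weight a b p i t h * signalProb a b i x < weight a b p j t h * signalProb a b j x := by
  have hP := isProbabilityMeasure_law (p := p) ha hb
  set A : Set Sample := {ω | observation (history (law a b p) t) t ω = (h, x)} with hA
  have hAm : MeasurableSet A := by
    have : A = ⋃ i, ({i} : Set (Fin 2)) ×ˢ {ω : Inputs | ((i, ω) : Sample) ∈ A} := by
      ext ⟨i, ω⟩
      simp
    rw [this]
    exact .iUnion fun i => (measurableSet_singleton i).prod
      (measurableSet_event i t fun h' x' _ => (h', x') = (h, x))
  have hjoint : ∀ k, (law a b p).real (A ∩ {ω | state ω = k})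
      = weight a b p k t h * signalProb a b k x / 2 := by
    intro k
    have hcond : (condLaw a b p k).real {ω | ((k, ω) : Sample) ∈ A ∩ {ω | state ω = k}}
        = weight a b p k t h * signalProb a b k x := by
      have h2 := condLaw_real_event (p := p) ha hb k t fun h' x' _ => h' = h ∧ x' = x
      have h3 : {ω | ((k, ω) : Sample) ∈ A ∩ {ω | state ω = k}} = {ω : Inputs |
          history (law a b p) t (k, ω) = h ∧ ω.1 t = x} := by
        ext ω
        simp [A, observation, signal, state]
      rw [h3, h2, Finset.sum_eq_single_of_mem h hh (by simp +contextual),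
        Finset.sum_eq_single_of_mem x (Finset.mem_univ _) (by simp +contextual)]
      simp [revealProb]
      ring
    have hother : ∀ l, l ≠ k → {ω | ((l, ω) : Sample) ∈ A ∩ {ω | state ω = k}} = ∅ := by
      intro l hl
      ext ω
      simp [state, hl]
    rw [law_real_eq ha hb]
    · fin_cases k
      · have := hother 1 (by simp)
        simp only [Fin.zero_eta, Fin.isValue] at *
        rw [hcond, this]
        simp
      · have := hother 0 (by simp)
        simp only [Fin.mk_one, Fin.isValue] at *
        rw [hcond, this]
        simp
    · intro l
      by_cases hl : l = k
      · subst hl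
        have := measurableSet_event (μ := law a b p) l t fun h' x' _ => (h', x') = (h, x)
        convert this using 1
        ext ω
        simp [A, observation, signal, state]
      · rw [hother l hl]
        exact .empty
  have hfin : ∀ k, law a b p (A ∩ {ω | state ω = k}) ≠ ⊤ := fun k => by finiteness
  have hlt : law a b p (A ∩ {ω | state ω = i}) < law a b p (A ∩ {ω | state ω = j}) ↔
      weight a b p i t h * signalProb a b i x < weight a b p j t h * signalProb a b j x := by
    rw [← ENNReal.toReal_lt_toReal (hfin i) (hfin j), ← measureReal_def, ← measureReal_def,
      hjoint, hjoint]
    constructor <;> intro _ <;> linarith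
  rw [posterior, posterior, ProbabilityTheory.cond_apply hAm, ProbabilityTheory.cond_apply hAm,
    ← hlt]
  -- On a null observation both posteriors and both joint probabilities are 0, so both strict
  -- comparisons fail.
  by_cases h0 : law a b p A = 0
  · rw [measure_mono_null Set.inter_subset_left h0, measure_mono_null Set.inter_subset_left h0]
    simp
  · exact ENNReal.mul_lt_mul_iff_right (by simp) (by simpa using h0)

end Model

/-! ### Decisions, the recursion for likelihood pairs, and error formulas -/

section Model

variable {a b : ℝ} {p : ℕ → unitInterval}

lemma div_add_eq_ratio_mul (hb : 0 < b) : a / (a + b) = a / b * (b / (a + b)) := by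
  field_simp

lemma decision_eq_one (hb : 0 < b) (hab : b < a) {t : ℕ} {h : List (Fin 2)} (hh : h ∈ words t)
    (hc : a / b * weight a b p 0 t h < weight a b p 1 t h) (x : Fin 2) :
    decision a b p t h x = 1 := by
  have ha : 0 < a := hb.trans hab
  have hx := weight_nonneg (a := a) (b := b) (p := p) 0 t h
  have hB : 0 < b / (a + b) := by positivity
  have hr : 1 < a / b := (one_lt_div hb).2 hab
  have hlt : weight a b p 0 t h * signalProb a b 0 x < weight a b p 1 t h * signalProb a b 1 x := by
    fin_cases x <;> simp only [signalProb, Fin.zero_eta, Fin.mk_one, Fin.isValue, if_true,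
      zero_ne_one, one_ne_zero, if_false, div_add_eq_ratio_mul (a := a) hb]
    · nlinarith
    · have : weight a b p 0 t h < weight a b p 1 t h := by nlinarith
      have h2 : weight a b p 0 t h < a / b * weight a b p 1 t h := by nlinarith
      nlinarith
  rw [decision, if_neg, if_pos]
  · exact (posterior_lt_posterior ha hb hh x 0 1).2 hlt
  · rw [posterior_lt_posterior ha hb hh x 1 0]
    exact hlt.not_gt

lemma decision_eq_zero (hb : 0 < b) (hab : b < a) {t : ℕ} {h : List (Fin 2)} (hh : h ∈ words t)
    (hc : a / b * weight a b p 1 t h < weight a b p 0 t h) (x : Fin 2) :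
    decision a b p t h x = 0 := by
  have ha : 0 < a := hb.trans hab
  have hx := weight_nonneg (a := a) (b := b) (p := p) 1 t h
  have hB : 0 < b / (a + b) := by positivity
  have hr : 1 < a / b := (one_lt_div hb).2 hab
  have hlt : weight a b p 1 t h * signalProb a b 1 x < weight a b p 0 t h * signalProb a b 0 x := by
    fin_cases x <;> simp only [signalProb, Fin.zero_eta, Fin.mk_one, Fin.isValue, if_true,
      zero_ne_one, one_ne_zero, if_false, div_add_eq_ratio_mul (a := a) hb]
    · have : weight a b p 1 t h < weight a b p 0 t h := by nlinarith
      have h2 : weight a b p 1 t h < a / b * weight a b p 0 t h := by nlinarith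
      nlinarith
    · nlinarith
  rw [decision, if_pos]
  exact (posterior_lt_posterior ha hb hh x 1 0).2 hlt

/-- At a likelihood ratio exactly r, a contrary signal makes the posteriors equal, and the tie rule
still returns the signal. Hence the strict inequalities in `branch`. -/
lemma decision_eq_self (hb : 0 < b) (hab : b < a) {t : ℕ} {h : List (Fin 2)} (hh : h ∈ words t)
    (hc : ¬a / b * weight a b p 0 t h < weight a b p 1 t h)
    (hc' : ¬a / b * weight a b p 1 t h < weight a b p 0 t h) (x : Fin 2) :
    decision a b p t h x = x := by
  have ha : 0 < a := hb.trans hab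
  have hB : 0 < b / (a + b) := by positivity
  simp only [decision, posterior_lt_posterior ha hb hh]
  fin_cases x <;> simp only [signalProb, Fin.zero_eta, Fin.mk_one, Fin.isValue, if_true,
      zero_ne_one, one_ne_zero, if_false, div_add_eq_ratio_mul (a := a) hb]
  · split_ifs with h1 h2
    · rfl
    · exact absurd h2 (by nlinarith)
    · rfl
  · split_ifs with h1 h2
    · exact absurd h1 (by nlinarith)
    · rfl
    · rfl

/-- Conditional probability, given the history and the state, that the next action is `z`. -/
lemma weight_succ (ha : 0 < a) (hb : 0 < b) (i : Fin 2) {t : ℕ} {h : List (Fin 2)}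
    (hh : h ∈ words t) (z : Fin 2) :
    weight a b p i (t + 1) (h ++ [z]) = weight a b p i t h *
      ∑ x, signalProb a b i x * ((p t : ℝ) * (if x = z then 1 else 0)
        + (1 - p t) * (if decision a b p t h x = z then 1 else 0)) := by
  have h1 := condLaw_real_event (p := p) ha hb i t fun h' x e =>
    h' = h ∧ (if e then x else decision a b p t h' x) = z
  have h2 : {ω : Inputs | history (law a b p) (t + 1) (i, ω) = h ++ [z]}
      = {ω : Inputs | history (law a b p) t (i, ω) = h ∧
        (if ω.2 t then ω.1 t else decision a b p t (history (law a b p) t (i, ω)) (ω.1 t)) = z} := by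
    ext ω
    simp only [Set.mem_ofPred_eq, history_succ, List.append_singleton_inj]
    rfl
  rw [weight, h2, h1, Finset.sum_eq_single_of_mem h hh (by simp +contextual), Finset.mul_sum]
  refine Finset.sum_congr rfl fun x _ => ?_
  simp only [Fintype.sum_bool, revealProb, if_true, Bool.false_eq_true, if_false, true_and]
  split_ifs <;> ring

/-- In each of the three regimes for the decision, `weight_succ` multiplies the pair by the factors
in `branch`. From here on the model enters only through r, B and q. -/
lemma sum_words_eq_treeSum (hb : 0 < b) (hab : b < a) (t : ℕ) (F : ℝ → ℝ → ℝ) :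
    ∑ h ∈ words t, F (weight a b p 0 t h) (weight a b p 1 t h)
      = treeSum (a / b) (b / (a + b)) (fun t => p t * (b / (a + b))) t F := by
  have ha : 0 < a := hb.trans hab
  have hs : a / (a + b) = 1 - b / (a + b) := by field_simp; ring
  have hAr := div_add_eq_ratio_mul (a := a) hb
  induction t generalizing F with
  | zero =>
    have h0 := sum_words_weight (p := p) ha hb 0 0
    have h1 := sum_words_weight (p := p) ha hb 1 0
    simp only [words, Finset.sum_singleton] at h0 h1 ⊢
    rw [h0, h1, treeSum]
  | succ t ih =>
    rw [treeSum, ← ih, sum_words_succ]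
    refine Finset.sum_congr rfl fun h hh => ?_
    have e0 : signalProb a b 0 0 = 1 - b / (a + b) := by simp [signalProb, hs]
    have e1 : signalProb a b 0 1 = b / (a + b) := by simp [signalProb]
    have e2 : signalProb a b 1 0 = b / (a + b) := by simp [signalProb]
    have e3 : signalProb a b 1 1 = 1 - b / (a + b) := by simp [signalProb, hs]
    have hq : a / b * ((p t : ℝ) * (b / (a + b))) = p t * (1 - b / (a + b)) := by
      rw [← hs, hAr]; ring
    have hq' : a / b * (b / (a + b)) = 1 - b / (a + b) := by rw [← hAr, hs]
    rw [weight_succ ha hb 0 hh, weight_succ ha hb 1 hh, weight_succ ha hb 0 hh,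
      weight_succ ha hb 1 hh, branch]
    simp only [Fin.sum_univ_two, e0, e1, e2, e3, hq, hq']
    by_cases hc : a / b * weight a b p 0 t h < weight a b p 1 t h
    · simp only [decision_eq_one hb hab hh hc, hc, Fin.isValue, if_true, zero_ne_one, one_ne_zero,
        if_false]
      ring_nf
    by_cases hc' : a / b * weight a b p 1 t h < weight a b p 0 t h
    · simp only [decision_eq_zero hb hab hh hc', hc, hc', Fin.isValue, if_true, zero_ne_one,
        one_ne_zero, if_false]
      ring_nf
    · simp only [decision_eq_self hb hab hh hc hc', hc, hc', Fin.isValue, if_true, zero_ne_one,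
        one_ne_zero, if_false]
      ring_nf

/-- Letting the guess `f` see the revealer indicator covers both the MAP estimate and the action. -/
lemma real_ne_state_eq (ha : 0 < a) (hb : 0 < b) (t : ℕ)
    (f : List (Fin 2) → Fin 2 → Bool → Fin 2) :
    (law a b p).real
        {ω | f (history (law a b p) t ω) (signal t ω) (isRevealer t ω) ≠ state ω}
      = ∑ h ∈ words t, ∑ x, ∑ e, revealProb (p t) e *
        ((if f h x e ≠ 0 then weight a b p 0 t h * signalProb a b 0 x else 0)
          + if f h x e ≠ 1 then weight a b p 1 t h * signalProb a b 1 x else 0) / 2 := by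
  rw [law_real_eq ha hb]
  · have h0 := condLaw_real_event (p := p) ha hb 0 t fun h x e => f h x e ≠ 0
    have h1 := condLaw_real_event (p := p) ha hb 1 t fun h x e => f h x e ≠ 1
    refine (congrArg₂ (fun u v : ℝ => (u + v) / 2) h0 h1).trans ?_
    simp only [← Finset.sum_add_distrib, Finset.sum_div]
    refine Finset.sum_congr rfl fun h _ => Finset.sum_congr rfl fun x _ =>
      Finset.sum_congr rfl fun e _ => ?_
    split_ifs <;> ring
  · exact fun i => measurableSet_event i t fun h x e => f h x e ≠ i

lemma mapErrorProb_eq (hb : 0 < b) (hab : b < a) (t : ℕ) :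
    mapErrorProb a b p t = treeSum (a / b) (b / (a + b)) (fun t => p t * (b / (a + b))) t
      (nodeError (a / b) (b / (a + b))) / 2 := by
  have ha : 0 < a := hb.trans hab
  have hs : a / (a + b) = 1 - b / (a + b) := by field_simp; ring
  rw [← sum_words_eq_treeSum hb hab, Finset.sum_div]
  refine (real_ne_state_eq (p := p) ha hb t fun h x _ => decision a b p t h x).trans ?_
  refine Finset.sum_congr rfl fun h hh => ?_
  have e0 : signalProb a b 0 0 = 1 - b / (a + b) := by simp [signalProb, hs]
  have e1 : signalProb a b 0 1 = b / (a + b) := by simp [signalProb]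
  have e2 : signalProb a b 1 0 = b / (a + b) := by simp [signalProb]
  have e3 : signalProb a b 1 1 = 1 - b / (a + b) := by simp [signalProb, hs]
  rw [nodeError]
  simp only [Fin.sum_univ_two, Fintype.sum_bool, revealProb, e0, e1, e2, e3, if_true,
    Bool.false_eq_true, if_false]
  by_cases hc : a / b * weight a b p 0 t h < weight a b p 1 t h
  · simp only [decision_eq_one hb hab hh hc, hc, Fin.isValue, ne_eq, not_true_eq_false,
      one_ne_zero, not_false_eq_true, if_true, if_false]
    ring
  by_cases hc' : a / b * weight a b p 1 t h < weight a b p 0 t h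
  · simp only [decision_eq_zero hb hab hh hc', hc, hc', Fin.isValue, ne_eq, not_true_eq_false,
      zero_ne_one, not_false_eq_true, if_true, if_false]
    ring
  · simp only [decision_eq_self hb hab hh hc hc', hc, hc', Fin.isValue, ne_eq, not_true_eq_false,
      zero_ne_one, one_ne_zero, not_false_eq_true, if_true, if_false]
    ring

/-- A revealer errs with probability b / (a + b) whatever the history, and the indicator is
independent of the history and the signal. -/
lemma errorProb_eq (ha : 0 < a) (hb : 0 < b) (t : ℕ) :
    errorProb a b p t = p t * (b / (a + b)) + (1 - p t) * mapErrorProb a b p t := by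
  have h1 := real_ne_state_eq (p := p) ha hb t fun h x e =>
    if e then x else decision a b p t h x
  have h2 := real_ne_state_eq (p := p) ha hb t fun h x _ => decision a b p t h x
  have h3 := sum_words_weight (p := p) ha hb 0 t
  have h4 := sum_words_weight (p := p) ha hb 1 t
  have h5 : (p t : ℝ) * (b / (a + b)) = ∑ h ∈ words t,
      p t * (b / (a + b)) * (weight a b p 0 t h + weight a b p 1 t h) / 2 := by
    rw [← Finset.sum_div, ← Finset.mul_sum, Finset.sum_add_distrib, h3, h4]
    ring
  refine h1.trans ?_
  rw [show mapErrorProb a b p t = _ from h2, h5, Finset.mul_sum, ← Finset.sum_add_distrib]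
  refine Finset.sum_congr rfl fun h _ => ?_
  have e1 : signalProb a b 0 1 = b / (a + b) := by simp [signalProb]
  have e2 : signalProb a b 1 0 = b / (a + b) := by simp [signalProb]
  simp only [Fin.sum_univ_two, Fintype.sum_bool, revealProb, e1, e2, if_true, Fin.isValue, ne_eq,
    not_true_eq_false, zero_ne_one, one_ne_zero, not_false_eq_true, Bool.false_eq_true, if_false]
  ring

end Model

/-! ### Asymptotics -/

section Asymptotics

variable {a b : ℝ} {p : ℕ → unitInterval}

lemma ratio_facts (hb : 0 < b) (hab : b < a) :
    1 < a / b ∧ b / (a + b) * (1 + a / b) = 1 ∧ 0 < b / (a + b) := by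
  have ha : 0 < a := hb.trans hab
  refine ⟨(one_lt_div hb).2 hab, ?_, by positivity⟩
  field_simp
  ring

lemma kappaStar_pos (hb : 0 < b) (hab : b < a) : 0 < kappaStar a b := by
  have hr := (ratio_facts hb hab).1
  have := rate_neg hr (optExponent_pos hr) (by linarith [optExponent_lt_half hr])
  rw [kappaStar_eq hb hab]
  exact inv_pos.2 (by linarith)

lemma rate_eq_neg_inv_kappaStar (hb : 0 < b) (hab : b < a) :
    rate (a / b) (optExponent (a / b)) = -(kappaStar a b)⁻¹ := by
  rw [kappaStar_eq hb hab, inv_inv, neg_neg]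

lemma mapErrorProb_nonneg (t : ℕ) : 0 ≤ mapErrorProb a b p t := measureReal_nonneg

lemma mapErrorProb_le (hb : 0 < b) (hab : b < a) (t : ℕ) :
    mapErrorProb a b p t ≤
      Real.exp (-(kappaStar a b)⁻¹ * ∑ i ∈ Finset.range t, (p i : ℝ) * (b / (a + b))) := by
  obtain ⟨hr, hB, hB0⟩ := ratio_facts hb hab
  have hγ := optExponent_pos hr
  have hγ' := optExponent_lt_half hr
  have hq : ∀ t, 0 ≤ (p t : ℝ) * (b / (a + b)) := fun t => mul_nonneg (p t).2.1 hB0.le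
  have hqB : ∀ t, (p t : ℝ) * (b / (a + b)) ≤ b / (a + b) := fun t =>
    mul_le_of_le_one_left hB0.le (p t).2.2
  have h1 := treeSum_mono hr hB hq hqB t (F := nodeError (a / b) (b / (a + b)))
    (G := symmGeo (optExponent (a / b))) fun x y hx hy =>
    (nodeError_le hr hB hx hy).trans (min_le_symmGeo hγ.le (by linarith) hx hy)
  have h2 := treeSum_symmGeo_le hr hB hγ hγ'.le hq hqB t
  rw [rate_eq_neg_inv_kappaStar hb hab] at h2
  rw [mapErrorProb_eq hb hab]
  have := Real.exp_pos (-(kappaStar a b)⁻¹ * ∑ i ∈ Finset.range t, (p i : ℝ) * (b / (a + b)))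
  linarith

lemma exists_le_mapErrorProb (hb : 0 < b) (hab : b < a)
    (hp : Tendsto (fun t => (p t : ℝ)) atTop (𝓝 0)) {δ : ℝ} (hδ : 0 < δ) :
    ∃ c > 0, ∀ᶠ t in atTop,
      c * Real.exp (-((kappaStar a b)⁻¹ + δ) * ∑ i ∈ Finset.range t, (p i : ℝ) * (b / (a + b)))
        ≤ mapErrorProb a b p t := by
  obtain ⟨hr, hB, hB0⟩ := ratio_facts hb hab
  have hq : ∀ t, 0 ≤ (p t : ℝ) * (b / (a + b)) := fun t => mul_nonneg (p t).2.1 hB0.le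
  have hqB : ∀ t, (p t : ℝ) * (b / (a + b)) ≤ b / (a + b) := fun t =>
    mul_le_of_le_one_left hB0.le (p t).2.2
  obtain ⟨c, hc, h⟩ := exists_le_treeSum_min hr hB hδ hq hqB
    (by simpa using hp.mul_const (b / (a + b)))
  refine ⟨b / (a + b) * c / 2, by positivity, ?_⟩
  filter_upwards [h] with t ht
  have h1 := treeSum_mono hr hB hq hqB t fun x y hx hy => mul_min_le_nodeError hr hB hx hy
  rw [treeSum_const_mul] at h1
  rw [mapErrorProb_eq hb hab]
  rw [rate_eq_neg_inv_kappaStar hb hab, ← neg_add'] at ht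
  have := mul_le_mul_of_nonneg_left ht hB0.le
  linarith

/-! ### Partial sums of the revealing probabilities -/

lemma sum_inv_eq_harmonic (t : ℕ) :
    ∑ i ∈ Finset.range t, 1 / ((i : ℝ) + 1) = (harmonic t : ℝ) := by
  simp [harmonic]

lemma sum_inv_le_one_add_log (t : ℕ) :
    ∑ i ∈ Finset.range t, 1 / ((i : ℝ) + 1) ≤ 1 + Real.log ((t : ℝ) + 1) := by
  rw [sum_inv_eq_harmonic]
  rcases t.eq_zero_or_pos with rfl | ht
  · simp
  · refine (harmonic_le_one_add_log t).trans ?_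
    gcongr
    linarith

lemma log_le_sum_inv (t : ℕ) :
    Real.log ((t : ℝ) + 1) ≤ ∑ i ∈ Finset.range t, 1 / ((i : ℝ) + 1) := by
  rw [sum_inv_eq_harmonic]
  exact_mod_cast log_add_one_le_harmonic t

/-- If `q i ≤ C / (i + 1)` eventually, then the partial sums grow at most like `C * log t`. -/
lemma exists_sum_le_mul_log {q : ℕ → ℝ} {C : ℝ} (hC : 0 ≤ C)
    (h : ∀ᶠ i : ℕ in atTop, q i ≤ C * (1 / ((i : ℝ) + 1))) :
    ∃ D, ∀ᶠ t : ℕ in atTop, ∑ i ∈ Finset.range t, q i ≤ D + C * Real.log ((t : ℝ) + 1) := by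
  obtain ⟨T, hT⟩ := eventually_atTop.1 h
  refine ⟨∑ i ∈ Finset.range T, q i + C, ?_⟩
  filter_upwards [eventually_ge_atTop T] with t ht
  have h1 : ∑ i ∈ Finset.Ico T t, q i ≤ ∑ i ∈ Finset.range t, C * (1 / ((i : ℝ) + 1)) := by
    refine (Finset.sum_le_sum fun i hi => hT i (Finset.mem_Ico.1 hi).1).trans
      (Finset.sum_le_sum_of_subset_of_nonneg ?_ fun i _ _ => by positivity)
    intro i hi
    exact Finset.mem_range.2 (Finset.mem_Ico.1 hi).2
  rw [← Finset.mul_sum] at h1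
  have h2 := mul_le_mul_of_nonneg_left (sum_inv_le_one_add_log t) hC
  rw [← Finset.sum_range_add_sum_Ico _ ht]
  linarith

lemma exists_mul_log_le_sum {q : ℕ → ℝ} {C : ℝ}
    (h : ∀ᶠ i : ℕ in atTop, C * (1 / ((i : ℝ) + 1)) ≤ q i) (hC : 0 ≤ C) :
    ∃ D, ∀ᶠ t : ℕ in atTop, C * Real.log ((t : ℝ) + 1) - D ≤ ∑ i ∈ Finset.range t, q i := by
  obtain ⟨T, hT⟩ := eventually_atTop.1 h
  refine ⟨∑ i ∈ Finset.range T, C * (1 / ((i : ℝ) + 1)) - ∑ i ∈ Finset.range T, q i, ?_⟩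
  filter_upwards [eventually_ge_atTop T] with t ht
  have h1 := Finset.sum_le_sum fun i (hi : i ∈ Finset.Ico T t) => hT i (Finset.mem_Ico.1 hi).1
  have h2 := mul_le_mul_of_nonneg_left (log_le_sum_inv t) hC
  rw [Finset.mul_sum, ← Finset.sum_range_add_sum_Ico _ ht] at h2
  rw [← Finset.sum_range_add_sum_Ico _ ht]
  linarith

lemma tendsto_log_succ : Tendsto (fun t : ℕ => Real.log ((t : ℝ) + 1)) atTop atTop :=
  Real.tendsto_log_atTop.comp (tendsto_natCast_atTop_atTop.atTop_add tendsto_const_nhds)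

lemma succ_eq_exp_log (t : ℕ) : (t : ℝ) + 1 = Real.exp (Real.log ((t : ℝ) + 1)) :=
  (Real.exp_log (by positivity)).symm

/-! ### Sharp threshold for the error -/

lemma tendsto_mul_mapErrorProb_zero (hb : 0 < b) (hab : b < a) {C : ℝ} (hC : kappaStar a b < C)
    (hp : ∀ᶠ i : ℕ in atTop, C * (1 / ((i : ℝ) + 1)) ≤ (p i : ℝ) * (b / (a + b))) :
    Tendsto (fun t : ℕ => ((t : ℝ) + 1) * mapErrorProb a b p t) atTop (𝓝 0) := by
  have hκ := kappaStar_pos hb hab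
  obtain ⟨D, hD⟩ := exists_mul_log_le_sum hp (by linarith)
  have hlim : Tendsto (fun t : ℕ => Real.exp ((kappaStar a b)⁻¹ * D
      + -((kappaStar a b)⁻¹ * (C - kappaStar a b) * Real.log ((t : ℝ) + 1)))) atTop (𝓝 0) := by
    refine Real.tendsto_exp_atBot.comp (tendsto_atBot_add_const_left _ _ ?_)
    refine tendsto_neg_atTop_atBot.comp (tendsto_log_succ.const_mul_atTop ?_)
    exact mul_pos (inv_pos.2 hκ) (by linarith)
  refine squeeze_zero' (.of_forall fun t => mul_nonneg (by positivity) (mapErrorProb_nonneg t)) ?_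
    hlim
  filter_upwards [hD] with t ht
  refine (mul_le_mul_of_nonneg_left (mapErrorProb_le hb hab t) (by positivity)).trans ?_
  nth_rewrite 1 [succ_eq_exp_log t]
  rw [← Real.exp_add, Real.exp_le_exp]
  have h1 := mul_le_mul_of_nonneg_left ht (inv_pos.2 hκ).le
  have h2 : (kappaStar a b)⁻¹ * kappaStar a b = 1 := inv_mul_cancel₀ hκ.ne'
  linear_combination h1 - Real.log ((t : ℝ) + 1) * h2

lemma tendsto_zero_of_le_mul_one_div (hb : 0 < b) (hab : b < a) {C : ℝ}
    (hp : ∀ᶠ i : ℕ in atTop, (p i : ℝ) * (b / (a + b)) ≤ C * (1 / ((i : ℝ) + 1))) :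
    Tendsto (fun t => (p t : ℝ)) atTop (𝓝 0) := by
  obtain ⟨-, -, hB0⟩ := ratio_facts hb hab
  have hq0 : Tendsto (fun t => (p t : ℝ) * (b / (a + b))) atTop (𝓝 0) := by
    refine squeeze_zero' (.of_forall fun t => mul_nonneg (p t).2.1 hB0.le) hp ?_
    simpa using tendsto_one_div_add_atTop_nhds_zero_nat.const_mul C
  have h := hq0.mul_const (b / (a + b))⁻¹
  rw [zero_mul] at h
  exact h.congr fun t => by rw [mul_assoc, mul_inv_cancel₀ hB0.ne', mul_one]

/-- The product is at least a constant times t ^ (1 - (1/κ⋆ + δ) C), with positive exponent for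
small δ. -/
lemma tendsto_mul_mapErrorProb_atTop (hb : 0 < b) (hab : b < a) {C : ℝ} (hC0 : 0 ≤ C)
    (hC : C < kappaStar a b)
    (hp : ∀ᶠ i : ℕ in atTop, (p i : ℝ) * (b / (a + b)) ≤ C * (1 / ((i : ℝ) + 1))) :
    Tendsto (fun t : ℕ => ((t : ℝ) + 1) * mapErrorProb a b p t) atTop atTop := by
  have hκ := kappaStar_pos hb hab
  have hp0 := tendsto_zero_of_le_mul_one_div hb hab hp
  have hfac : 0 < kappaStar a b - C := by linarith
  obtain ⟨δ, hδ, hδC⟩ : ∃ δ > 0, ((kappaStar a b)⁻¹ + δ) * C < 1 := by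
    -- With this δ the claim becomes (κ⋆ - C)(2κ⋆ - C) > 0.
    refine ⟨(kappaStar a b - C) / (2 * kappaStar a b * kappaStar a b), by positivity, ?_⟩
    have h1 : ((kappaStar a b)⁻¹ + (kappaStar a b - C) / (2 * kappaStar a b * kappaStar a b)) * C
        = (3 * kappaStar a b - C) * C / (2 * kappaStar a b * kappaStar a b) := by
      field_simp
      ring
    rw [h1, div_lt_one (by positivity)]
    nlinarith
  obtain ⟨c, hc, hlow⟩ := exists_le_mapErrorProb hb hab hp0 hδ
  obtain ⟨D, hD⟩ := exists_sum_le_mul_log hC0 hp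
  set ρ := (kappaStar a b)⁻¹ + δ with hρ
  have hρ0 : 0 ≤ ρ := by positivity
  have hlim : Tendsto (fun t : ℕ => c * Real.exp (-(ρ * D) + (1 - ρ * C) * Real.log ((t : ℝ) + 1)))
      atTop atTop := by
    refine (Real.tendsto_exp_atTop.comp (tendsto_atTop_add_const_left _ _ ?_)).const_mul_atTop hc
    exact tendsto_log_succ.const_mul_atTop (by linarith)
  refine tendsto_atTop_mono' _ ?_ hlim
  filter_upwards [hlow, hD] with t h1 h2
  refine le_trans ?_ (mul_le_mul_of_nonneg_left h1 (by positivity))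
  nth_rewrite 2 [succ_eq_exp_log t]
  rw [mul_left_comm, ← Real.exp_add]
  apply mul_le_mul_of_nonneg_left _ hc.le
  rw [Real.exp_le_exp]
  have := mul_le_mul_of_nonneg_left h2 hρ0
  linear_combination this

/-- With revealing probabilities slightly above the critical ones, learning has the optimal
rate. -/
lemma tendsto_errorProb (hb : 0 < b) (hab : b < a) {ε : ℝ} (hε : 0 < ε)
    (hp : ∀ t : ℕ, (p t : ℝ) =
      min ((1 + ε) * ((a + b) / b) * (kappaStar a b / ((t : ℝ) + 1))) 1) :
    Tendsto (fun t : ℕ => ((t : ℝ) + 1) * errorProb a b p t) atTop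
        (𝓝 ((1 + ε) * kappaStar a b)) ∧
      Tendsto (fun t : ℕ => ((t : ℝ) + 1) * mapErrorProb a b p t) atTop (𝓝 0) := by
  have ha : 0 < a := hb.trans hab
  have hκ := kappaStar_pos hb hab
  have hpt : ∀ᶠ t : ℕ in atTop,
      (p t : ℝ) * (b / (a + b)) = (1 + ε) * kappaStar a b * (1 / ((t : ℝ) + 1)) := by
    have h0 : Tendsto (fun t : ℕ => (1 + ε) * ((a + b) / b) * kappaStar a b * (1 / ((t : ℝ) + 1)))
        atTop (𝓝 0) := by
      simpa using tendsto_one_div_add_atTop_nhds_zero_nat.const_mul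
        ((1 + ε) * ((a + b) / b) * kappaStar a b)
    filter_upwards [h0.eventually_le_const zero_lt_one] with t ht
    rw [hp, min_eq_left]
    · field_simp
    · refine le_trans (le_of_eq ?_) ht
      ring
  have hmap := tendsto_mul_mapErrorProb_zero (p := p) hb hab
    (show kappaStar a b < (1 + ε) * kappaStar a b by nlinarith) (hpt.mono fun t ht => ht.ge)
  have hp0 := tendsto_zero_of_le_mul_one_div hb hab (hpt.mono fun t ht => ht.le)
  refine ⟨?_, hmap⟩
  have hlim : Tendsto (fun t : ℕ => (1 + ε) * kappaStar a b
      + (1 - (p t : ℝ)) * (((t : ℝ) + 1) * mapErrorProb a b p t)) atTop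
      (𝓝 ((1 + ε) * kappaStar a b + (1 - 0) * 0)) :=
    tendsto_const_nhds.add ((tendsto_const_nhds.sub hp0).mul hmap)
  rw [mul_zero, add_zero] at hlim
  refine hlim.congr' ?_
  filter_upwards [hpt] with t ht
  have ht1 : ((t : ℝ) + 1) * (1 / ((t : ℝ) + 1)) = 1 := mul_one_div_cancel (by positivity)
  rw [errorProb_eq ha hb, ht]
  linear_combination (-(1 + ε) * kappaStar a b) * ht1

/-- An error below d/t with d < κ⋆ bounds the revealers' share q by d/t. The MAP error is then
ω(1/t), and since p tends to 0 the Bayesians alone exceed the assumed error. -/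
lemma kappaStar_le_limsup (hb : 0 < b) (hab : b < a) (p : ℕ → unitInterval) :
    ((kappaStar a b : ℝ) : EReal) ≤
      limsup (fun t : ℕ => ((((t : ℝ) + 1) * errorProb a b p t : ℝ) : EReal)) atTop := by
  have ha : 0 < a := hb.trans hab
  by_contra! hlt
  obtain ⟨d, hd1, hd2⟩ := EReal.lt_iff_exists_real_btwn.1 hlt
  have hd2 : d < kappaStar a b := EReal.coe_lt_coe_iff.1 hd2
  have hev : ∀ᶠ t : ℕ in atTop, ((t : ℝ) + 1) * errorProb a b p t < d :=
    (eventually_lt_of_limsup_lt hd1).mono fun t ht => EReal.coe_lt_coe_iff.1 ht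
  have hp : ∀ᶠ t : ℕ in atTop, (p t : ℝ) * (b / (a + b)) ≤ max d 0 * (1 / ((t : ℝ) + 1)) := by
    filter_upwards [hev] with t ht
    rw [mul_one_div, le_div_iff₀ (by positivity)]
    refine le_trans ?_ (ht.le.trans (le_max_left _ _))
    rw [mul_comm, errorProb_eq ha hb]
    have := mul_nonneg (sub_nonneg.2 (p t).2.2) (mapErrorProb_nonneg (a := a) (b := b) (p := p) t)
    gcongr
    linarith
  have hmap := tendsto_mul_mapErrorProb_atTop hb hab (le_max_right d 0)
    (max_lt hd2 (kappaStar_pos hb hab)) hp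
  have hp0 := tendsto_zero_of_le_mul_one_div hb hab hp
  obtain ⟨t, h1, h2, h3⟩ := (hev.and ((hmap.eventually_ge_atTop (2 * max d 0)).and
    (hp0.eventually_le_const (show (0 : ℝ) < 1 / 2 by norm_num)))).exists
  rw [errorProb_eq ha hb] at h1
  have h4 : 0 ≤ ((t : ℝ) + 1) * ((p t : ℝ) * (b / (a + b))) := by
    have := (p t).2.1
    positivity
  have h5 : 0 ≤ ((t : ℝ) + 1) * mapErrorProb a b p t :=
    mul_nonneg (by positivity) (mapErrorProb_nonneg t)
  have := le_max_left d 0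
  nlinarith

lemma iInf_limsup_le_kappaStar (hb : 0 < b) (hab : b < a) :
    ⨅ p : ℕ → unitInterval,
        limsup (fun t : ℕ => ((((t : ℝ) + 1) * errorProb a b p t : ℝ) : EReal)) atTop
      ≤ ((kappaStar a b : ℝ) : EReal) := by
  have ha : 0 < a := hb.trans hab
  have hκ := kappaStar_pos hb hab
  refine le_of_forall_gt_imp_ge_of_dense fun c hc => ?_
  obtain ⟨d, hd1, hd2⟩ := EReal.lt_iff_exists_real_btwn.1 hc
  have hd1 : kappaStar a b < d := EReal.coe_lt_coe_iff.1 hd1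
  obtain ⟨ε, hε, rfl⟩ : ∃ ε > 0, d = (1 + ε) * kappaStar a b :=
    ⟨d / kappaStar a b - 1, by rw [gt_iff_lt, sub_pos, one_lt_div hκ]; exact hd1, by field_simp; ring⟩
  let p : ℕ → unitInterval := fun t =>
    ⟨min ((1 + ε) * ((a + b) / b) * (kappaStar a b / ((t : ℝ) + 1))) 1,
      le_min (by positivity) zero_le_one, min_le_right _ _⟩
  have h := (tendsto_errorProb (p := p) hb hab hε fun t => rfl).1
  have h' := (continuous_coe_real_ereal.tendsto _).comp h
  exact (iInf_le _ p).trans (h'.limsup_eq.le.trans hd2.le)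

lemma tendsto_mul_mapErrorProb_of_limsup_le (hb : 0 < b) (hab : b < a) {ε : ℝ} (hε : 0 < ε)
    (hp : limsup (fun t : ℕ => ((((t : ℝ) + 1) * (p t : ℝ) : ℝ) : EReal)) atTop
      ≤ (((1 - ε) * ((a + b) / b) * kappaStar a b : ℝ) : EReal)) :
    Tendsto (fun t : ℕ => ((t : ℝ) + 1) * mapErrorProb a b p t) atTop atTop := by
  have ha : 0 < a := hb.trans hab
  have hκ := kappaStar_pos hb hab
  have hlt : (1 - ε) * ((a + b) / b) * kappaStar a b
      < (1 - ε / 2) * ((a + b) / b) * kappaStar a b := by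
    gcongr
    linarith
  -- Halving ε turns the bound on the limsup into an eventual one; the maximum with 0 covers large
  -- ε.
  refine tendsto_mul_mapErrorProb_atTop (C := max ((1 - ε / 2) * kappaStar a b) 0) hb hab
    (le_max_right _ _) (max_lt (by nlinarith) hκ) ?_
  filter_upwards [eventually_lt_of_limsup_lt (hp.trans_lt (EReal.coe_lt_coe_iff.2 hlt))] with t ht
  have ht := EReal.coe_lt_coe_iff.1 ht
  rw [mul_one_div, le_div_iff₀ (by positivity)]
  refine le_trans ?_ (le_max_left _ _)
  calc (p t : ℝ) * (b / (a + b)) * ((t : ℝ) + 1) = ((t : ℝ) + 1) * p t * (b / (a + b)) := by ring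
    _ ≤ (1 - ε / 2) * ((a + b) / b) * kappaStar a b * (b / (a + b)) := by gcongr
    _ = _ := by field_simp

end Asymptotics

end InformationCascade

theorem theorem1 (a b : ℝ) (hb : 0 < b) (hab : b < a) :
    -- the optimal learning constant, as an infimum over all sequences of revealing probabilities
    (⨅ p : ℕ → unitInterval,
        limsup (fun t : ℕ =>
          ((((t : ℝ) + 1) * InformationCascade.errorProb a b p t : ℝ) : EReal)) atTop)
      = ((InformationCascade.kappaStar a b : ℝ) : EReal) ∧
    -- the optimum is approached by explicit revealing probabilities
    (∀ ε : ℝ, 0 < ε → ∀ p : ℕ → unitInterval,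
      (∀ t : ℕ, (p t : ℝ) =
        min ((1 + ε) * ((a + b) / b) * (InformationCascade.kappaStar a b / ((t : ℝ) + 1))) 1) →
      Tendsto (fun t : ℕ => ((t : ℝ) + 1) * InformationCascade.errorProb a b p t) atTop
          (𝓝 ((1 + ε) * InformationCascade.kappaStar a b)) ∧
        (fun t : ℕ => InformationCascade.mapErrorProb a b p t)
          =o[atTop] (fun t : ℕ => 1 / ((t : ℝ) + 1))) ∧
    -- with too few revealers the maximum a posteriori estimate errs too often
    (∀ ε : ℝ, 0 < ε → ∀ p : ℕ → unitInterval,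
      limsup (fun t : ℕ => ((((t : ℝ) + 1) * (p t : ℝ) : ℝ) : EReal)) atTop
          ≤ (((1 - ε) * ((a + b) / b) * InformationCascade.kappaStar a b : ℝ) : EReal) →
      Tendsto (fun t : ℕ =>
        InformationCascade.mapErrorProb a b p t / (1 / ((t : ℝ) + 1))) atTop atTop) := by
  refine ⟨le_antisymm (InformationCascade.iInf_limsup_le_kappaStar hb hab)
    (le_iInf fun p => InformationCascade.kappaStar_le_limsup hb hab p), fun ε hε p hp => ?_,
    fun ε hε p hp => ?_⟩
  · obtain ⟨h1, h2⟩ := InformationCascade.tendsto_errorProb hb hab hε hp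
    refine ⟨h1, (isLittleO_iff_tendsto' (.of_forall fun t ht => ?_)).2 (h2.congr fun t => ?_)⟩
    · exact absurd ht (by positivity)
    · rw [div_div_eq_mul_div, div_one, mul_comm]
  · refine (InformationCascade.tendsto_mul_mapErrorProb_of_limsup_le hb hab hε hp).congr fun t => ?_
    rw [div_div_eq_mul_div, div_one, mul_comm]
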